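/- For integers $n\ge 1$, the unbranched George groups of window size $n$ are the following groups of permutations of $\mathbb Z$; each is described by its set of unfrozen integers (all other integers, called frozen, are fixed by every element) and by the symmetries its elements respect: - $S_n$: unfrozen integers $1,\dots,n$; no further condition. - $S^B_n$: unfrozen integers $\pm1,\dots,\pm n$; $w(-i)=-w(i)$ for all $i$. - $\widetilde S_n$: all integers unfrozen; $w(i+n)=w(i)+n$ for all $i$, and $\sum_{i=1}^n w(i)=\sum_{i=1}^n i$. - $\widetilde S^C_n$: unfrozen integers $\mathbb Z\smallsetminus (n+1)\mathbb Z$; $w(-i)=-w(i)$ and $w(2(n+1)-i)=2(n+1)-w(i)$ for all $i$. Write $\langle (i\ j)\rangle$ for the extension of the transposition $(i\ j)$ under the symmetries of the group. The simple transpositions of each group are $s_i=\langle(i\ i{+}1)\rangle$ for $1\le i\le n-1$, together with $s_0=s_n=\langle (0\ 1)\rangle$ in $\widetilde S_n$ (for $n\ge2$; the group $\widetilde S_1$ is trivial and has no generators), $s_0=\langle(-1\ 1)\rangle$ in $S^B_n$, and $s_0=\langle(-1\ 1)\rangle$, $s_n=\langle(n\ n{+}2)\rangle$ in $\widetilde S^C_n$.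 Let $\ell_S(w)$ be the least length of a word $i_1\cdots i_\ell$ with $w=s_{i_1}\cdots s_{i_\ell}$; the words attaining it are the reduced words for $w$. In $\widetilde S_n$ the letters $0$ and $n$ are identified. Let $\mathrm{dis}(w)=\sum_{i=1}^n|w(i)-i|$. Say that $w$ globally avoids $321$ if there are no unfrozen integers $i<j<k$ with $w(i)>w(j)>w(k)$. **Theorem.** Let $w$ be an element of an unbranched George group of window size $n$. The following are equivalent: (A) $\mathrm{dis}(w)/2=\ell_S(w)$; (B) in every reduced word for $w$, for all $i\in\{1,\dots,n-1\}$, between every two copies of $i$ there is both a copy of $i-1$ and a copy of $i+1$; (C) $w$ globally avoids $321$. Moreover, in the nondegenerate cases ($S_n$ and $S^B_n$ for $n\ge1$, $\widetilde S_n$ for $n\ge3$, $\widetilde S^C_n$ for $n\ge2$), these properties are also equivalent to (B$'$) no reduced word for $w$ contains consecutive letters $i\,(i+1)\,i$ or $i\,(i-1)\,i$ with $i\in\{1,\dots,n-1\}$. -/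

import Mathlib

/-- The four families of unbranched George groups: `S_n`, `S^B_n`, affine `S_n`, affine `S^C_n`. -/
inductive GeorgeType : Type
  | S
  | SB
  | affS
  | affSC
  deriving DecidableEq

namespace GeorgeType

/-- The unfrozen integers of the group of type `t` and window size `n`. All other integers
are fixed by every element of the group. -/
def unfrozen : GeorgeType → ℕ → Set ℤ
  | S, n => {x | 1 ≤ x ∧ x ≤ n}
  | SB, n => {x | x ≠ 0 ∧ -(n : ℤ) ≤ x ∧ x ≤ n}
  | affS, _ => Set.univ
  | affSC, n => {x | ¬ ((n : ℤ) + 1) ∣ x}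

/-- The symmetry conditions. An affine permutation is, as usual, also required to be balanced:
its window `w(1), …, w(n)` has sum `1 + ⋯ + n`. -/
def Respects : GeorgeType → ℕ → Equiv.Perm ℤ → Prop
  | S, _, _ => True
  | SB, _, w => ∀ x, w (-x) = -w x
  | affS, n, w => (∀ x, w (x + n) = w x + n) ∧
      ∑ i ∈ Finset.Icc (1 : ℤ) n, w i = ∑ i ∈ Finset.Icc (1 : ℤ) n, i
  | affSC, n, w => (∀ x, w (-x) = -w x) ∧
      ∀ x, w (2 * ((n : ℤ) + 1) - x) = 2 * ((n : ℤ) + 1) - w x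

theorem sum_window_comp (n : ℕ) (v : Equiv.Perm ℤ) (hv : ∀ x, v (x + n) = v x + n)
    (f : ℤ → ℤ) (hf : ∀ x, f (x + n) = f x) :
    ∑ i ∈ Finset.Icc (1 : ℤ) n, f (v i) = ∑ i ∈ Finset.Icc (1 : ℤ) n, f i := by
  rcases Nat.eq_zero_or_pos n with rfl | hn
  · simp
  have hn' : (0 : ℤ) < n := by exact_mod_cast hn
  have hvk : ∀ (k x : ℤ), v (x + k * n) = v x + k * n := by
    have hp : Function.Periodic (fun x => v x - x) (n : ℤ) := fun x => by
      simp only [hv]; ring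
    intro k x
    have h : v (x + k * n) - (x + k * n) = v x - x := by simpa using hp.int_mul k x
    linarith
  have hfk : ∀ y : ℤ, f ((y - 1) % n + 1) = f y := by
    intro y
    have hp : Function.Periodic f (n : ℤ) := hf
    have h := hp.int_mul ((y - 1) / n) ((y - 1) % n + 1)
    rw [← h]
    congr 1
    have := Int.emod_add_mul_ediv (y - 1) n
    simp only [Int.cast_id]
    linarith
  have hmaps : ∀ i ∈ Finset.Icc (1 : ℤ) n, (v i - 1) % n + 1 ∈ Finset.Icc (1 : ℤ) n := by
    intro i _
    have h1 := Int.emod_nonneg (v i - 1) hn'.ne'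
    have h2 := Int.emod_lt_of_pos (v i - 1) hn'
    rw [Finset.mem_Icc]
    constructor <;> linarith
  have hinj : Set.InjOn (fun i : ℤ => (v i - 1) % n + 1) (Finset.Icc (1 : ℤ) n) := by
    intro i hi j hj hij
    simp only [Finset.coe_Icc, Set.mem_Icc] at hi hj
    simp only [add_left_inj] at hij
    obtain ⟨k, hk⟩ := Int.ModEq.dvd (n := (n : ℤ)) hij.symm
    have h3 : v i = v (j + k * n) := by rw [hvk]; linarith
    have h4 := v.injective h3
    have h5 : k = 0 := by
      by_contra hk0
      rcases lt_or_gt_of_ne hk0 with h | h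
      · nlinarith
      · nlinarith
    simpa [h5] using h4
  refine Finset.sum_nbij (fun i : ℤ => (v i - 1) % n + 1) hmaps hinj ?_ ?_
  · exact Finset.surjOn_of_injOn_of_card_le _ hmaps hinj le_rfl
  · intro i _
    exact (hfk (v i)).symm

/-- The unbranched George group of type `t` and window size `n`, as a group of permutations
of `ℤ`. -/
def group (t : GeorgeType) (n : ℕ) : Subgroup (Equiv.Perm ℤ) where
  carrier := {w | (∀ x, x ∉ t.unfrozen n → w x = x) ∧ t.Respects n w}
  one_mem' := by
    refine ⟨fun _ _ => rfl, ?_⟩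
    cases t <;> simp [Respects]
  mul_mem' := by
    rintro u v ⟨hu, hu'⟩ ⟨hv, hv'⟩
    refine ⟨fun x hx => by simp [Equiv.Perm.mul_apply, hv x hx, hu x hx], ?_⟩
    cases t
    · trivial
    · simp only [Respects] at *
      intro x
      simp [Equiv.Perm.mul_apply, hv', hu']
    · simp only [Respects] at *
      refine ⟨fun x => by simp [Equiv.Perm.mul_apply, hv'.1, hu'.1], ?_⟩
      have h := sum_window_comp n v hv'.1 (fun x => u x - x) (fun x => by rw [hu'.1]; ring)
      simp only [Finset.sum_sub_distrib] at h
      simp only [Equiv.Perm.mul_apply]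
      linarith [hu'.2, hv'.2]
    · simp only [Respects] at *
      exact ⟨fun x => by simp [Equiv.Perm.mul_apply, hv'.1, hu'.1],
        fun x => by simp [Equiv.Perm.mul_apply, hv'.2, hu'.2]⟩
  inv_mem' := by
    rintro w ⟨hw, hw'⟩
    refine ⟨fun x hx => by rw [Equiv.Perm.inv_eq_iff_eq]; exact (hw x hx).symm, ?_⟩
    cases t
    · trivial
    · simp only [Respects] at *
      intro x
      rw [Equiv.Perm.inv_eq_iff_eq, hw', (show ∀ y, w (w⁻¹ y) = y from w.apply_symm_apply)]
    · simp only [Respects] at *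
      have hp : ∀ x, w⁻¹ (x + n) = w⁻¹ x + n := fun x => by
        rw [Equiv.Perm.inv_eq_iff_eq, hw'.1, (show ∀ y, w (w⁻¹ y) = y from w.apply_symm_apply)]
      refine ⟨hp, ?_⟩
      have h := sum_window_comp n w hw'.1 (fun x => w⁻¹ x - x) (fun x => by rw [hp]; ring)
      simp only [Finset.sum_sub_distrib, show ∀ y, w⁻¹ (w y) = y from w.symm_apply_apply] at h
      linarith [hw'.2]
    · simp only [Respects] at *
      exact ⟨fun x => by rw [Equiv.Perm.inv_eq_iff_eq, hw'.1, (show ∀ y, w (w⁻¹ y) = y from w.apply_symm_apply)],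
        fun x => by rw [Equiv.Perm.inv_eq_iff_eq, hw'.2, (show ∀ y, w (w⁻¹ y) = y from w.apply_symm_apply)]⟩

/-- The permutation of `ℤ` that swaps `a + k N` with `b + k N` for every `k ∈ ℤ`
(for `N = 0`, the transposition `(a b)`); the identity if `a` and `b` are congruent mod `N`. -/
def periodicSwap (N a b : ℤ) : Equiv.Perm ℤ :=
  if h : N ∣ b - a then 1 else
    Function.Involutive.toPerm
      (fun x => if N ∣ x - a then x + (b - a) else if N ∣ x - b then x - (b - a) else x) (by
        intro x
        simp only
        by_cases h1 : N ∣ x - a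
        · have h2 : ¬ N ∣ x + (b - a) - a := fun h3 => h (by
            have := dvd_sub h3 h1; ring_nf at this ⊢; exact this)
          have h4 : N ∣ x + (b - a) - b := by ring_nf at h1 ⊢; exact h1
          simp [h1, h2, h4]
        · by_cases h2 : N ∣ x - b
          · have h4 : N ∣ x - (b - a) - a := by ring_nf at h2 ⊢; exact h2
            simp [h1, h2, h4]
          · simp [h1, h2])

/-- The simple transposition `s_i`. Here `s_i = ⟨(i i+1)⟩` for `1 ≤ i ≤ n - 1`; moreover
`s_0 = ⟨(0 1)⟩` in affine `S_n`, `s_0 = ⟨(-1 1)⟩` in `S^B_n` and affine `S^C_n`, and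
`s_n = ⟨(n n+2)⟩` in affine `S^C_n`. -/
def simple : GeorgeType → ℕ → ℕ → Equiv.Perm ℤ
  | S, _, i => periodicSwap 0 i (i + 1)
  | SB, _, i =>
      if i = 0 then periodicSwap 0 (-1) 1
      else periodicSwap 0 i (i + 1) * periodicSwap 0 (-i) (-(i + 1))
  | affS, n, i => periodicSwap n i (i + 1)
  | affSC, n, i =>
      if i = 0 then periodicSwap (2 * (n + 1)) (-1) 1
      else if i = n then periodicSwap (2 * (n + 1)) n (n + 2)
      else periodicSwap (2 * (n + 1)) i (i + 1) * periodicSwap (2 * (n + 1)) (-i) (-(i + 1))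

/-- `i` is the index of a generator `s_i`. In affine `S_n` the generators are indexed by
`0, …, n - 1`, where `s_n = s_0`; the trivial group affine `S_1` has no generators. -/
def IsLetter : GeorgeType → ℕ → ℕ → Prop
  | S, n, i => 1 ≤ i ∧ i < n
  | SB, n, i => i < n
  | affS, n, i => 2 ≤ n ∧ i < n
  | affSC, n, i => i ≤ n

/-- The letter meant by the index `i`: indices are read modulo `n` in affine `S_n`
(there `s_n = s_0`), and literally in the other groups. -/
def letter : GeorgeType → ℕ → ℕ → ℕ
  | affS, n, i => i % n
  | S, _, i => i
  | SB, _, i => i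
  | affSC, _, i => i

/-- `l = [i₁, …, i_k]` is a word in the generators whose product `s_{i₁} ⋯ s_{i_k}` is `w`. -/
def IsWord (t : GeorgeType) (n : ℕ) (w : Equiv.Perm ℤ) (l : List ℕ) : Prop :=
  (∀ i ∈ l, t.IsLetter n i) ∧ (l.map (t.simple n)).prod = w

/-- The Coxeter length `ℓ_S(w)`. -/
noncomputable def coxeterLength (t : GeorgeType) (n : ℕ) (w : Equiv.Perm ℤ) : ℕ :=
  sInf {k | ∃ l : List ℕ, t.IsWord n w l ∧ l.length = k}

def IsReducedWord (t : GeorgeType) (n : ℕ) (w : Equiv.Perm ℤ) (l : List ℕ) : Prop :=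
  t.IsWord n w l ∧ l.length = t.coxeterLength n w

/-- `w` globally contains the pattern `p`. -/
def GloballyContains (t : GeorgeType) (n : ℕ) (w : Equiv.Perm ℤ) {k : ℕ}
    (p : Equiv.Perm (Fin k)) : Prop :=
  ∃ x : Fin k → ℤ, StrictMono x ∧ (∀ a, x a ∈ t.unfrozen n) ∧
    ∀ a b, w (x a) < w (x b) ↔ p a < p b

/-- Between any two copies of `i` in the word `l` there is a copy of `j`. -/
def Separated (l : List ℕ) (i j : ℕ) : Prop :=
  ∀ p q : ℕ, p < q → l[p]? = some i → l[q]? = some i →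
    ∃ r, p < r ∧ r < q ∧ l[r]? = some j

/-- In every reduced word for `w`, for all `i ∈ [n - 1]`, every two copies of `i` are separated
by a copy of `i - 1` and by a copy of `i + 1`. -/
def ReducedWordsSeparated (t : GeorgeType) (n : ℕ) (w : Equiv.Perm ℤ) : Prop :=
  ∀ l, t.IsReducedWord n w l → ∀ i, 1 ≤ i → i ≤ n - 1 →
    Separated l i (t.letter n (i - 1)) ∧ Separated l i (t.letter n (i + 1))

/-- No reduced word for `w` contains consecutive letters `i (i ± 1) i` with `i ∈ [n - 1]`. -/
def ReducedWordsAvoidTriples (t : GeorgeType) (n : ℕ) (w : Equiv.Perm ℤ) : Prop :=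
  ∀ l, t.IsReducedWord n w l → ∀ i, 1 ≤ i → i ≤ n - 1 →
    ¬ [i, t.letter n (i - 1), i] <:+: l ∧ ¬ [i, t.letter n (i + 1), i] <:+: l

/-- The nondegenerate unbranched George groups. -/
def Nondegenerate : GeorgeType → ℕ → Prop
  | S, n => 1 ≤ n
  | SB, n => 1 ≤ n
  | affS, n => 3 ≤ n
  | affSC, n => 2 ≤ n

end GeorgeType

/-- The disarray (total displacement) `∑_{i=1}^n |w(i) - i|`. -/
noncomputable def disarray (n : ℕ) (w : Equiv.Perm ℤ) : ℤ := ∑ i ∈ Finset.Icc (1 : ℤ) n, |w i - i|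

/-- The pattern `321`. -/
def pattern321 : Equiv.Perm (Fin 3) := Fin.revPerm

/-! All four families are handled at once by recording a period (`0` for the finite groups), whether
negation is a symmetry, and for each generator the adjacent unfrozen pair $a<b$ that it swaps, with
$b=a+1$, or $b=a+2$ when the pair straddles a frozen centre of reflection.

Right multiplication of $v$ by $s_i$ raises the disarray by at most $2$, with equality exactly when
$v(a)\le a$ and $b\le v(b)$ (`disarray_mul_simple`); call this a gain. Hence $\mathrm{dis}(w)\le
2\ell_S(w)$, and (A) says that every letter of one, equivalently every, reduced word is a gain.

(A) and (C). Balance is the main tool: if some value crosses a cut of $\mathbb Z$ in one direction,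
another crosses it in the other (`exists_crossing_up`, `exists_crossing_down`). These crossings
supply the missing third point of a $321$, so a gain creates no first $321$ (`Gain.not_has321`), and
a descent of a $321$-avoiding element is the undoing of a gain (`gain_mul_simple_of_descent`).
Stripping descents then yields a word of length $\mathrm{dis}(w)/2$ (`exists_word`).

(A) implies (B). After a gain at $i$ the value at $a$ exceeds $a$, while a later gain at $i$ needs
it to be at most $a$. Among the other letters only $i-1$ moves $a$, so $i-1$ occurs in between; the
point $b$ gives $i+1$ in the same way.

(B) implies (B$'$) because a forbidden triple separates two copies of $i$ by only one of two
distinct neighbours. For (B$'$) implies (A), look at the first letter $i$ of a reduced word that is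
not a gain. The prefix consists of gains and must contain an earlier $i$ with no $i-1$, or no $i+1$,
in between (`AllGain.exists_last_of_lt`, `AllGain.exists_last_of_gt`). Commutations turn such a pair
into a triple in some reduced word (`exists_triple`). -/

namespace GeorgeType

/-! ### Uniform description of the four families -/

/-- The translation under which the group of type `t` and window size `n` is periodic. -/
def period : GeorgeType → ℕ → ℤ
  | S, _ => 0
  | SB, _ => 0
  | affS, n => n
  | affSC, n => 2 * (n + 1)

/-- The elements of the group commute with negation. -/
def IsSymm : GeorgeType → Prop
  | S => False
  | SB => True
  | affS => False
  | affSC => True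

/-- The smaller of the two adjacent unfrozen integers swapped by the generator `s_i`. -/
def left : GeorgeType → ℕ → ℕ → ℤ
  | S, _, i => i
  | SB, _, i => if i = 0 then -1 else i
  | affS, _, i => i
  | affSC, _, i => if i = 0 then -1 else i

/-- The larger of the two adjacent unfrozen integers swapped by the generator `s_i`. -/
def right : GeorgeType → ℕ → ℕ → ℤ
  | S, _, i => i + 1
  | SB, _, i => i + 1
  | affS, _, i => i + 1
  | affSC, n, i => if i = n then n + 2 else i + 1

/-- The integers which the generator `s_i` moves up. -/
def Up (t : GeorgeType) (n i : ℕ) (x : ℤ) : Prop :=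
  t.period n ∣ x - t.left n i ∨ (t.IsSymm ∧ t.period n ∣ x + t.right n i)

/-- The integers which the generator `s_i` moves down. -/
def Down (t : GeorgeType) (n i : ℕ) (x : ℤ) : Prop :=
  t.period n ∣ x - t.right n i ∨ (t.IsSymm ∧ t.period n ∣ x + t.left n i)

variable {t : GeorgeType} {n : ℕ} {w : Equiv.Perm ℤ}

theorem apply_frozen (hw : w ∈ t.group n) {x : ℤ} (hx : x ∉ t.unfrozen n) : w x = x :=
  hw.1 x hx

theorem apply_unfrozen (hw : w ∈ t.group n) {x : ℤ} (hx : x ∈ t.unfrozen n) :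
    w x ∈ t.unfrozen n := by
  by_contra h
  exact h ((w.injective (hw.1 _ h)).symm ▸ hx)

theorem unfrozen_of_ne (hw : w ∈ t.group n) {x : ℤ} (hx : w x ≠ x) : x ∈ t.unfrozen n := by
  by_contra h
  exact hx (hw.1 x h)

theorem apply_neg (hw : w ∈ t.group n) (ht : t.IsSymm) (x : ℤ) : w (-x) = -w x := by
  obtain ⟨-, h⟩ := hw
  cases t
  · exact ht.elim
  · exact h x
  · exact ht.elim
  · exact h.1 x

theorem apply_add_period (hw : w ∈ t.group n) (x : ℤ) :
    w (x + t.period n) = w x + t.period n := by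
  obtain ⟨-, h⟩ := hw
  cases t
  · simp [period]
  · simp [period]
  · exact h.1 x
  · have h1 := h.2 (-x)
    rw [h.1 x, sub_neg_eq_add, sub_neg_eq_add] at h1
    simp only [period]
    rw [add_comm x, h1]
    ring

theorem apply_add_mul_period (hw : w ∈ t.group n) (x k : ℤ) :
    w (x + k * t.period n) = w x + k * t.period n := by
  have hp : Function.Periodic (fun x => w x - x) (t.period n) := fun x => by
    simp only [apply_add_period hw]; ring
  have h : w (x + k * t.period n) - (x + k * t.period n) = w x - x := by
    simpa using hp.int_mul k x
  linarith

theorem unfrozen_add_mul_period (x k : ℤ) :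
    x + k * t.period n ∈ t.unfrozen n ↔ x ∈ t.unfrozen n := by
  cases t
  · simp [period]
  · simp [period]
  · simp [unfrozen]
  · simp only [unfrozen, period, Set.mem_ofPred_eq, not_iff_not]
    exact dvd_add_left ⟨k * 2, by ring⟩

theorem unfrozen_neg (ht : t.IsSymm) (x : ℤ) : -x ∈ t.unfrozen n ↔ x ∈ t.unfrozen n := by
  cases t
  · exact ht.elim
  · simp only [unfrozen, Set.mem_ofPred_eq]; omega
  · exact ht.elim
  · simp [unfrozen]

/-- Distinct multiples of $N$ differ by at least $N$. The alternative $N=0$ lets the finite groups,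
where congruence is equality, share every argument with the affine ones. -/
theorem not_dvd_of_dvd {N y z : ℤ} (h : N ∣ y) (h0 : z ≠ y)
    (hN : N = 0 ∨ (z - y < N ∧ y - z < N)) : ¬ N ∣ z := by
  intro hz
  have h1 := dvd_sub hz h
  rcases hN with rfl | hN
  · exact h0 (sub_eq_zero.1 (zero_dvd_iff.1 h1))
  · exact h0 (sub_eq_zero.1 (Int.eq_zero_of_abs_lt_dvd h1 (abs_lt.2 ⟨by omega, by omega⟩)))

theorem not_dvd_of_small {N z : ℤ} (h0 : z ≠ 0) (hN : N = 0 ∨ (z < N ∧ -z < N)) : ¬ N ∣ z :=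
  not_dvd_of_dvd (dvd_zero N) h0 (by simpa using hN)

theorem periodicSwap_apply {N a b : ℤ} (h : ¬ N ∣ b - a) (x : ℤ) :
    periodicSwap N a b x =
      if N ∣ x - a then x + (b - a) else if N ∣ x - b then x - (b - a) else x := by
  simp [periodicSwap, h, Function.Involutive.toPerm]


/-! ### The generators as permutations -/

section Letters

variable {i : ℕ} {x : ℤ}

/-- The four shapes of generator: no reflection symmetry; an interior letter of a symmetric group;
the reflection at $0$; the reflection at $n+1$. Later arithmetic on `left`, `right` and `period`
splits on these shapes rather than on the families. -/
theorem letter_cases (hn : 1 ≤ n) (hi : t.IsLetter n i) :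
    (¬ t.IsSymm ∧ t.left n i = i ∧ t.right n i = i + 1 ∧ (t.period n = 0 ∨ 2 ≤ t.period n) ∧
      t.simple n i = periodicSwap (t.period n) i (i + 1)) ∨
    (t.IsSymm ∧ 1 ≤ i ∧ i < n ∧ t.left n i = i ∧ t.right n i = i + 1 ∧
      (t.period n = 0 ∨ t.period n = 2 * n + 2) ∧
      t.simple n i = periodicSwap (t.period n) i (i + 1) *
        periodicSwap (t.period n) (-i) (-(i + 1))) ∨
    (t.IsSymm ∧ i = 0 ∧ t.left n i = -1 ∧ t.right n i = 1 ∧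
      (t.period n = 0 ∨ t.period n = 2 * n + 2) ∧
      t.simple n i = periodicSwap (t.period n) (-1) 1) ∨
    (t = affSC ∧ t.IsSymm ∧ i = n ∧ t.left n i = n ∧ t.right n i = n + 2 ∧
      t.period n = 2 * n + 2 ∧
      t.simple n i = periodicSwap (t.period n) n (n + 2)) := by
  cases t
  · simp [left, right, IsSymm, period, simple]
  · rcases Nat.eq_zero_or_pos i with rfl | h
    · simp [left, right, IsSymm, period, simple]
    · have h1 : i < n := hi
      have h2 : i ≠ 0 := by omega
      right; left
      simp only [left, right, IsSymm, period, simple, h2, if_false]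
      simp; omega
  · have h : 2 ≤ n := hi.1
    left
    simp [left, right, IsSymm, period, simple, h]
  · rcases Nat.eq_zero_or_pos i with rfl | h
    · have h2 : 0 ≠ n := by omega
      right; right; left
      simp only [left, right, IsSymm, period, simple, h2, if_false]
      simp; omega
    · have h2 : i ≠ 0 := by omega
      by_cases h3 : i = n
      · right; right; right
        simp only [left, right, IsSymm, period, simple, h3, if_true]
        have : n ≠ 0 := by omega
        simp [this]; omega
      · right; left
        simp only [left, right, IsSymm, period, simple, h2, h3, if_false]
        have : i ≤ n := hi
        refine ⟨trivial, by omega, by omega, trivial, trivial, by omega, trivial⟩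

theorem left_lt_right (hn : 1 ≤ n) (hi : t.IsLetter n i) : t.left n i < t.right n i := by
  rcases letter_cases hn hi with h | h | h | h <;> omega

theorem not_dvd_right_sub_left (hn : 1 ≤ n) (hi : t.IsLetter n i) :
    ¬ t.period n ∣ t.right n i - t.left n i := by
  rcases letter_cases hn hi with h | h | h | h <;> apply not_dvd_of_small <;> omega

theorem not_dvd_two_mul_left (hn : 1 ≤ n) (hi : t.IsLetter n i) (ht : t.IsSymm) :
    ¬ t.period n ∣ 2 * t.left n i := by
  rcases letter_cases hn hi with h | h | h | h
  · exact absurd ht h.1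
  all_goals apply not_dvd_of_small <;> omega

theorem not_dvd_two_mul_right (hn : 1 ≤ n) (hi : t.IsLetter n i) (ht : t.IsSymm) :
    ¬ t.period n ∣ 2 * t.right n i := by
  rcases letter_cases hn hi with h | h | h | h
  · exact absurd ht h.1
  · apply not_dvd_of_small <;> omega
  · apply not_dvd_of_small <;> omega
  · apply not_dvd_of_dvd (dvd_refl _) <;> omega

theorem not_down_of_up (hn : 1 ≤ n) (hi : t.IsLetter n i) (hx : t.Up n i x) :
    ¬ t.Down n i x := by
  rintro (h | ⟨ht, h⟩) <;> rcases hx with h' | ⟨ht', h'⟩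
  · exact not_dvd_right_sub_left hn hi (by simpa [two_mul] using dvd_sub h' h)
  · exact not_dvd_two_mul_right hn hi ht' (by simpa [two_mul] using dvd_sub h' h)
  · exact not_dvd_two_mul_left hn hi ht (by simpa [two_mul] using dvd_sub h h')
  · exact not_dvd_right_sub_left hn hi (by simpa [two_mul] using dvd_sub h' h)

/-- The bound on $N$ makes the classes of $\pm a$ and $\pm(a+1)$ pairwise distinct, so the two
factors have disjoint supports. -/
theorem symmetricSwap_apply {N a : ℤ} (ha : 0 < a) (hN : N = 0 ∨ 2 * a + 2 < N) (x : ℤ) :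
    (periodicSwap N a (a + 1) * periodicSwap N (-a) (-(a + 1))) x =
      if N ∣ x - a ∨ N ∣ x + (a + 1) then x + 1
      else if N ∣ x - (a + 1) ∨ N ∣ x + a then x - 1 else x := by
  have h1 : ¬ N ∣ a + 1 - a := by apply not_dvd_of_small <;> omega
  have h2 : ¬ N ∣ -(a + 1) - -a := by apply not_dvd_of_small <;> omega
  rw [Equiv.Perm.mul_apply, periodicSwap_apply h2]
  have e1 : x - -a = x + a := by ring
  have e2 : x - -(a + 1) = x + (a + 1) := by ring
  have e3 : x + (-(a + 1) - -a) = x - 1 := by ring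
  have e4 : x - (-(a + 1) - -a) = x + 1 := by ring
  rw [e1, e2, e3, e4]
  by_cases h3 : N ∣ x + a
  · have f1 : ¬ N ∣ x - a := by apply not_dvd_of_dvd h3 <;> omega
    have f2 : ¬ N ∣ x + (a + 1) := by apply not_dvd_of_dvd h3 <;> omega
    have f3 : ¬ N ∣ x - 1 - a := by apply not_dvd_of_dvd h3 <;> omega
    have f4 : ¬ N ∣ x - 1 - (a + 1) := by apply not_dvd_of_dvd h3 <;> omega
    simp only [h3, f1, f2, f3, f4, periodicSwap_apply h1, if_true, if_false, or_true, or_false]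
  by_cases h4 : N ∣ x + (a + 1)
  · have f3 : ¬ N ∣ x + 1 - a := by apply not_dvd_of_dvd h4 <;> omega
    have f4 : ¬ N ∣ x + 1 - (a + 1) := by apply not_dvd_of_dvd h4 <;> omega
    simp only [h3, h4, f3, f4, periodicSwap_apply h1, if_true, if_false, or_true]
  simp only [h3, h4, periodicSwap_apply h1, if_false, or_false]
  simp

theorem simple_apply (hn : 1 ≤ n) (hi : t.IsLetter n i) (x : ℤ) [Decidable (t.Up n i x)]
    [Decidable (t.Down n i x)] :
    t.simple n i x = if t.Up n i x then x + (t.right n i - t.left n i)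
      else if t.Down n i x then x - (t.right n i - t.left n i) else x := by
  have h0 := not_dvd_right_sub_left hn hi
  rcases letter_cases hn hi with ⟨h, ha, hb, -, hs⟩ | ⟨h, h1, h2, ha, hb, hN, hs⟩ |
    ⟨h, -, ha, hb, hN, hs⟩ | ⟨-, h, -, ha, hb, hN, hs⟩
  · rw [ha, hb] at h0
    rw [hs, periodicSwap_apply h0]
    simp only [Up, Down, ha, hb, h, false_and, or_false]
  · rw [hs, symmetricSwap_apply (by omega) (by omega)]
    simp only [Up, Down, ha, hb, h, true_and]
    congr <;> ring
  · rw [ha, hb] at h0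
    rw [hs, periodicSwap_apply h0]
    simp only [Up, Down, ha, hb, h, true_and, sub_neg_eq_add, ← sub_eq_add_neg, or_self]
  · rw [ha, hb] at h0
    rw [hs, periodicSwap_apply h0]
    have e1 : t.period n ∣ x + (n + 2) ↔ t.period n ∣ x - n := by
      rw [← dvd_sub_self_right]; apply iff_of_eq; congr 1; rw [hN]; ring
    have e2 : t.period n ∣ x + n ↔ t.period n ∣ x - (n + 2) := by
      rw [← dvd_sub_self_right]; apply iff_of_eq; congr 1; rw [hN]; ring
    simp only [Up, Down, ha, hb, h, true_and, e1, e2, or_self]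

theorem simple_up (hn : 1 ≤ n) (hi : t.IsLetter n i) (hx : t.Up n i x) :
    t.simple n i x = x + (t.right n i - t.left n i) := by
  classical
  rw [simple_apply hn hi, if_pos hx]

theorem simple_down (hn : 1 ≤ n) (hi : t.IsLetter n i) (hx : t.Down n i x) :
    t.simple n i x = x - (t.right n i - t.left n i) := by
  classical
  rw [simple_apply hn hi, if_neg fun h => not_down_of_up hn hi h hx, if_pos hx]

theorem simple_fixed (hn : 1 ≤ n) (hi : t.IsLetter n i) (h : ¬ t.Up n i x)
    (h' : ¬ t.Down n i x) : t.simple n i x = x := by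
  classical
  rw [simple_apply hn hi, if_neg h, if_neg h']

theorem up_left : t.Up n i (t.left n i) := by simp [Up]

theorem down_right : t.Down n i (t.right n i) := by simp [Down]

theorem up_neg (ht : t.IsSymm) : t.Up n i (-x) ↔ t.Down n i x := by
  simp only [Up, Down, ht, true_and]
  rw [show -x - t.left n i = -(x + t.left n i) by ring,
    show -x + t.right n i = -(x - t.right n i) by ring, dvd_neg, dvd_neg, or_comm]

theorem down_neg (ht : t.IsSymm) : t.Down n i (-x) ↔ t.Up n i x := by
  rw [← up_neg ht, neg_neg]

theorem up_add_mul_period (k : ℤ) : t.Up n i (x + k * t.period n) ↔ t.Up n i x := by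
  simp only [Up]
  rw [add_sub_right_comm, add_right_comm, dvd_add_left (Dvd.intro_left _ rfl),
    dvd_add_left (Dvd.intro_left _ rfl)]

theorem down_add_mul_period (k : ℤ) : t.Down n i (x + k * t.period n) ↔ t.Down n i x := by
  simp only [Down]
  rw [add_sub_right_comm, add_right_comm, dvd_add_left (Dvd.intro_left _ rfl),
    dvd_add_left (Dvd.intro_left _ rfl)]

theorem up_add_period : t.Up n i (x + t.period n) ↔ t.Up n i x := by
  simpa using up_add_mul_period (t := t) (n := n) (i := i) (x := x) 1

theorem down_add_period : t.Down n i (x + t.period n) ↔ t.Down n i x := by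
  simpa using down_add_mul_period (t := t) (n := n) (i := i) (x := x) 1

theorem down_of_up (hx : t.Up n i x) : t.Down n i (x + (t.right n i - t.left n i)) := by
  refine hx.imp (fun h => ?_) (fun h => ⟨h.1, ?_⟩)
  · convert h using 1; ring
  · convert h.2 using 1; ring

theorem up_of_down (hx : t.Down n i x) : t.Up n i (x - (t.right n i - t.left n i)) := by
  refine hx.imp (fun h => ?_) (fun h => ⟨h.1, ?_⟩)
  · convert h using 1; ring
  · convert h.2 using 1; ring

theorem simple_simple (hn : 1 ≤ n) (hi : t.IsLetter n i) (x : ℤ) :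
    t.simple n i (t.simple n i x) = x := by
  by_cases h : t.Up n i x
  · rw [simple_up hn hi h, simple_down hn hi (down_of_up h)]; ring
  by_cases h' : t.Down n i x
  · rw [simple_down hn hi h', simple_up hn hi (up_of_down h')]; ring
  · rw [simple_fixed hn hi h h', simple_fixed hn hi h h']

theorem simple_mul_simple (hn : 1 ≤ n) (hi : t.IsLetter n i) :
    t.simple n i * t.simple n i = 1 :=
  Equiv.ext fun x => simple_simple hn hi x

theorem simple_left (hn : 1 ≤ n) (hi : t.IsLetter n i) :
    t.simple n i (t.left n i) = t.right n i := by
  rw [simple_up hn hi up_left]; ring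

theorem simple_right (hn : 1 ≤ n) (hi : t.IsLetter n i) :
    t.simple n i (t.right n i) = t.left n i := by
  rw [simple_down hn hi down_right]; ring

theorem simple_add_period (hn : 1 ≤ n) (hi : t.IsLetter n i) (x : ℤ) :
    t.simple n i (x + t.period n) = t.simple n i x + t.period n := by
  classical
  simp only [simple_apply hn hi, up_add_period, down_add_period]
  split_ifs <;> ring

theorem simple_neg (hn : 1 ≤ n) (hi : t.IsLetter n i) (ht : t.IsSymm) (x : ℤ) :
    t.simple n i (-x) = -t.simple n i x := by
  by_cases h : t.Up n i x
  · rw [simple_up hn hi h, simple_down hn hi ((down_neg ht).2 h)]; ring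
  by_cases h' : t.Down n i x
  · rw [simple_down hn hi h', simple_up hn hi ((up_neg ht).2 h')]; ring
  · rw [simple_fixed hn hi h h', simple_fixed hn hi (by rwa [up_neg ht]) (by rwa [down_neg ht])]

theorem left_mem_unfrozen (hn : 1 ≤ n) (hi : t.IsLetter n i) : t.left n i ∈ t.unfrozen n := by
  cases t
  · simp only [IsLetter, left, unfrozen, Set.mem_ofPred_eq] at *; omega
  · simp only [IsLetter, left, unfrozen, Set.mem_ofPred_eq] at *; split_ifs <;> omega
  · trivial
  · simp only [IsLetter, left, unfrozen, Set.mem_ofPred_eq] at *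
    apply not_dvd_of_small <;> split_ifs <;> omega

theorem right_mem_unfrozen (hn : 1 ≤ n) (hi : t.IsLetter n i) : t.right n i ∈ t.unfrozen n := by
  cases t
  · simp only [IsLetter, right, unfrozen, Set.mem_ofPred_eq] at *; omega
  · simp only [IsLetter, right, unfrozen, Set.mem_ofPred_eq] at *; omega
  · trivial
  · simp only [IsLetter, right, unfrozen, Set.mem_ofPred_eq] at *
    split_ifs
    · apply not_dvd_of_dvd (dvd_refl _) <;> omega
    · apply not_dvd_of_small <;> omega

theorem unfrozen_iff_of_dvd_sub {y : ℤ} (h : t.period n ∣ x - y) :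
    x ∈ t.unfrozen n ↔ y ∈ t.unfrozen n := by
  obtain ⟨k, hk⟩ := h
  rw [← unfrozen_add_mul_period y k, show y + k * t.period n = x by linarith]

theorem unfrozen_iff_of_dvd_add {y : ℤ} (ht : t.IsSymm) (h : t.period n ∣ x + y) :
    x ∈ t.unfrozen n ↔ y ∈ t.unfrozen n := by
  rw [← unfrozen_neg ht y]
  exact unfrozen_iff_of_dvd_sub (by rwa [sub_neg_eq_add])

theorem unfrozen_of_up (hn : 1 ≤ n) (hi : t.IsLetter n i) (hx : t.Up n i x) :
    x ∈ t.unfrozen n := by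
  rcases hx with h | ⟨ht, h⟩
  · exact (unfrozen_iff_of_dvd_sub h).2 (left_mem_unfrozen hn hi)
  · exact (unfrozen_iff_of_dvd_add ht h).2 (right_mem_unfrozen hn hi)

theorem unfrozen_of_down (hn : 1 ≤ n) (hi : t.IsLetter n i) (hx : t.Down n i x) :
    x ∈ t.unfrozen n := by
  rcases hx with h | ⟨ht, h⟩
  · exact (unfrozen_iff_of_dvd_sub h).2 (right_mem_unfrozen hn hi)
  · exact (unfrozen_iff_of_dvd_add ht h).2 (left_mem_unfrozen hn hi)

end Letters
end GeorgeType

/-! ### Sums over the window, and balance across a cut -/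

namespace GeorgeType

variable {t : GeorgeType} {n : ℕ} {w : Equiv.Perm ℤ} {i : ℕ} {x : ℤ}

theorem eq_of_dvd_sub_of_small {N y z : ℤ} (h : N ∣ y - z)
    (hN : N = 0 ∨ (z - y < N ∧ y - z < N)) : y = z := by
  by_contra h0
  exact not_dvd_of_small (by omega) (by omega) h

/-- Up to the symmetries, $s_i$ moves only `left` and `right`, and the window represents each of
them once, except that a reflection identifies the two and the window holds a single representative.
This reduces any change of a window sum under $s_i$ to one or two terms. -/
theorem window_sum (hn : 1 ≤ n) (hi : t.IsLetter n i) (F : ℤ → ℤ)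
    (hF : ∀ x, F (x + t.period n) = F x) (hF' : t.IsSymm → ∀ x, F (-x) = F x)
    (h0 : ∀ x, ¬ t.Up n i x → ¬ t.Down n i x → F x = 0) :
    (t.right n i = t.left n i + 1 ∧
      ∑ x ∈ Finset.Icc (1 : ℤ) n, F x = F (t.left n i) + F (t.right n i)) ∨
    (t.IsSymm ∧ t.right n i = t.left n i + 2 ∧ t.left n i + 1 ∉ t.unfrozen n ∧
      t.period n ∣ t.left n i + t.right n i ∧
      F (t.right n i) = F (t.left n i) ∧
      ∑ x ∈ Finset.Icc (1 : ℤ) n, F x = F (t.left n i)) := by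
  have key : ∀ T : Finset ℤ, T ⊆ Finset.Icc (1 : ℤ) n →
      (∀ x : ℤ, 1 ≤ x → x ≤ n → t.Up n i x ∨ t.Down n i x → x ∈ T) →
      ∑ x ∈ Finset.Icc (1 : ℤ) n, F x = ∑ x ∈ T, F x := by
    intro T hT h
    refine (Finset.sum_subset hT fun x hx hx' => ?_).symm
    rw [Finset.mem_Icc] at hx
    have h1 := mt (h x hx.1 hx.2) hx'
    rw [not_or] at h1
    exact h0 x h1.1 h1.2
  have plain : 1 ≤ i → i < n → t.left n i = i → t.right n i = i + 1 →
      (∀ x : ℤ, 1 ≤ x → x ≤ n → t.Up n i x → x = i) →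
      (∀ x : ℤ, 1 ≤ x → x ≤ n → t.Down n i x → x = i + 1) →
      ∑ x ∈ Finset.Icc (1 : ℤ) n, F x = F (t.left n i) + F (t.right n i) := by
    intro h1 h2 ha hb hu hd
    rw [key {(i : ℤ), (i : ℤ) + 1}, Finset.sum_pair (by omega), ha, hb]
    · intro x
      simp only [Finset.mem_insert, Finset.mem_singleton, Finset.mem_Icc]
      omega
    · intro x hx hx' h
      rcases h with h | h
      · simp [hu x hx hx' h]
      · simp [hd x hx hx' h]
  rcases letter_cases hn hi with ⟨h, ha, hb, -, -⟩ | ⟨h, h1, h2, ha, hb, hN, -⟩ |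
    ⟨h, hi0, ha, hb, hN, -⟩ | ⟨rfl, h, rfl, ha, hb, hN, -⟩
  · left
    refine ⟨by omega, ?_⟩
    simp only [Up, Down, h, false_and, or_false, ha, hb] at plain key ⊢
    cases t
    · exact plain hi.1 hi.2 trivial trivial
        (fun x h1 h2 h => eq_of_dvd_sub_of_small h (by simp [period]))
        (fun x h1 h2 h => eq_of_dvd_sub_of_small h (by simp [period]))
    · exact (h trivial).elim
    · have hin : i < n := hi.2
      have hn2 : 2 ≤ n := hi.1
      simp only [period] at *
      rcases Nat.eq_zero_or_pos i with rfl | hi1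
      -- The generator $\langle(0\ 1)\rangle$ meets the window in $1$ and in $n$, the translate of
      -- $0$.
      · rw [key {1, (n : ℤ)}, Finset.sum_pair (by omega)]
        · have := hF 0
          rw [zero_add] at this
          simp only [Nat.cast_zero, zero_add]
          rw [this, add_comm]
        · intro x
          simp only [Finset.mem_insert, Finset.mem_singleton, Finset.mem_Icc]
          omega
        · intro x hx hx' h
          rw [Finset.mem_insert, Finset.mem_singleton]
          rcases h with h | h
          · right
            apply eq_of_dvd_sub_of_small (N := n) _ (by omega)
            rw [dvd_sub_self_right]
            simpa using h
          · left
            apply eq_of_dvd_sub_of_small (N := n) _ (by omega)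
            simpa using h
      · exact plain hi1 hin trivial trivial
          (fun x h1 h2 h => eq_of_dvd_sub_of_small h (by omega))
          (fun x h1 h2 h => eq_of_dvd_sub_of_small h (by omega))
    · exact (h trivial).elim
  · left
    refine ⟨by omega, ?_⟩
    simp only [Up, Down, h, true_and, ha, hb] at plain key ⊢
    refine plain h1 h2 trivial trivial ?_ ?_
    · rintro x hx hx' (h | h)
      · exact eq_of_dvd_sub_of_small h (by omega)
      · exact (not_dvd_of_small (by omega) (by omega) h).elim
    · rintro x hx hx' (h | h)
      · exact eq_of_dvd_sub_of_small h (by omega)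
      · exact (not_dvd_of_small (by omega) (by omega) h).elim
  · right
    refine ⟨h, by omega, ?_, ?_, ?_, ?_⟩
    · cases t
      · exact h.elim
      · simp [ha, unfrozen]
      · exact h.elim
      · simp [ha, unfrozen]
    · simp [ha, hb]
    · rw [ha, hb, hF' h]
    · simp only [Up, Down, h, true_and, ha, hb] at key
      rw [key {1}, Finset.sum_singleton, ha, hF' h]
      · simp; omega
      · intro x hx hx' h
        rw [Finset.mem_singleton]
        rcases h with (h | h) | (h | h)
        · exact (not_dvd_of_small (by omega) (by omega) h).elim
        · exact (not_dvd_of_small (by omega) (by omega) h).elim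
        · exact eq_of_dvd_sub_of_small h (by omega)
        · exact eq_of_dvd_sub_of_small h (by omega)
  · right
    have e : (i : ℤ) + 2 = -i + affSC.period i := by omega
    refine ⟨h, by omega, ?_, ?_, ?_, ?_⟩
    · simp [ha, unfrozen]
    · rw [ha, hb, hN]; exact ⟨1, by ring⟩
    · rw [ha, hb, e, hF, hF' h]
    · simp only [Up, Down, h, true_and, ha, hb] at key
      rw [key {(i : ℤ)}, Finset.sum_singleton, ha]
      · simp; omega
      · intro x hx hx' h
        rw [Finset.mem_singleton]
        rcases h with (h | h) | (h | h)
        · exact eq_of_dvd_sub_of_small h (by omega)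
        · by_contra hne
          exact not_dvd_of_dvd (dvd_refl _) (by omega) (by omega) h
        · by_contra hne
          exact not_dvd_of_dvd (dvd_neg.2 (dvd_refl _)) (by omega) (by omega) h
        · exact (not_dvd_of_small (by omega) (by omega) h).elim

theorem simple_mem_group (hn : 1 ≤ n) (hi : t.IsLetter n i) : t.simple n i ∈ t.group n := by
  refine ⟨fun x hx => simple_fixed hn hi (mt (unfrozen_of_up hn hi) hx)
    (mt (unfrozen_of_down hn hi) hx), ?_⟩
  have hodd := simple_neg hn hi
  have hper := simple_add_period hn hi
  cases t
  · trivial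
  · exact hodd trivial
  · refine ⟨hper, ?_⟩
    have h := window_sum hn hi (fun x => affS.simple n i x - x)
      (fun x => by simp only [hper]; ring) (fun h => h.elim)
      (fun x hx hx' => by simp only [simple_fixed hn hi hx hx', sub_self])
    simp only [simple_left hn hi, simple_right hn hi, Finset.sum_sub_distrib] at h
    rcases h with h | h
    · linarith [h.2]
    · exact h.1.elim
  · refine ⟨hodd trivial, fun x => ?_⟩
    have h := hper (-x)
    rw [hodd trivial] at h
    simp only [period] at h
    rw [sub_eq_neg_add, h]
    ring

/-- Otherwise $w$ would map $(-\infty,x]$ into itself. If the unfrozen set is bounded below, a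
finite count makes this map onto, leaving no room for $w(y)$. In the periodic groups the balance
condition on the window replaces the count. -/
theorem exists_crossing_up (hn : 1 ≤ n) (hw : w ∈ t.group n) {x y : ℤ} (hy : x < y)
    (hwy : w y ≤ x) : ∃ z ≤ x, x < w z := by
  by_contra! hc
  have fin : (∀ z, z ∈ t.unfrozen n → -(n : ℤ) ≤ z) → False := by
    intro hU
    have hfix : ∀ z, z < -(n : ℤ) → w z = z := fun z hz =>
      apply_frozen hw fun h => by have := hU z h; omega
    set I := Finset.Icc (-(n : ℤ)) x
    have hmaps : ∀ z ∈ I, w z ∈ I := by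
      intro z hz
      rw [Finset.mem_Icc] at hz ⊢
      refine ⟨?_, hc z hz.2⟩
      by_contra h
      have := w.injective (hfix _ (not_le.1 h))
      omega
    have hsurj : Set.SurjOn w I I :=
      Finset.surjOn_of_injOn_of_card_le _ hmaps w.injective.injOn le_rfl
    by_cases h : -(n : ℤ) ≤ w y
    · obtain ⟨z, hz, hzy⟩ := hsurj (Finset.mem_coe.2 (Finset.mem_Icc.2 ⟨h, hwy⟩))
      have := w.injective hzy
      rw [Finset.mem_coe, Finset.mem_Icc] at hz
      omega
    · have := w.injective (hfix _ (not_le.1 h))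
      omega
  have per : ∀ N : ℕ, 0 < N → (∀ z, w (z + N) = w z + N) →
      ∑ z ∈ Finset.Icc (1 : ℤ) N, w z = ∑ z ∈ Finset.Icc (1 : ℤ) N, z → False := by
    intro N hN hper hsum
    have hN' : (0 : ℤ) < N := by omega
    have hperk : ∀ z k : ℤ, w (z + k * N) = w z + k * N := by
      have hp : Function.Periodic (fun x => w x - x) (N : ℤ) := fun x => by
        simp only [hper]; ring
      intro z k
      have h : w (z + k * N) - (z + k * N) = w z - z := by simpa using hp.int_mul k z
      linarith
    -- The index of the length-$N$ block containing $z$, with blocks cut at $x$: it is negative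
    -- exactly for $z\le x$.
    let g : ℤ → ℤ := fun z => (z - x - 1) / N
    have hg : ∀ z, g (z + N) = g z + 1 := fun z => by
      simp only [g]
      rw [show z + N - x - 1 = z - x - 1 + 1 * N by ring, Int.add_mul_ediv_right _ _ hN'.ne']
    have hle : ∀ z, g (w z) ≤ g z := by
      intro z
      have h1 : z - x - 1 < (g z + 1) * N := Int.lt_ediv_add_one_mul_self _ hN'
      have h2 := hc (z + (-(g z + 1)) * N) (by linarith)
      rw [hperk] at h2
      have h3 : g (w z) < g z + 1 := by
        apply Int.ediv_lt_of_lt_mul hN'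
        linarith
      omega
    -- Since $g(z)N-z$ is $N$-periodic and $w$ is balanced, $g\circ w$ and $g$ have equal window
    -- sums; the pointwise inequality is therefore an equality everywhere, which fails at $y$.
    have h := sum_window_comp N w hper (fun z => g z * N - z) (fun z => by simp only [hg]; ring)
    simp only [Finset.sum_sub_distrib, ← Finset.sum_mul] at h
    have hg' : ∑ z ∈ Finset.Icc (1 : ℤ) N, g (w z) = ∑ z ∈ Finset.Icc (1 : ℤ) N, g z := by
      apply mul_right_cancel₀ hN'.ne'
      linarith
    have heq := (Finset.sum_eq_sum_iff_of_le fun z _ => hle z).1 hg'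
    have hgk : Function.Periodic (fun z => g (w z) - g z) (N : ℤ) := fun z => by
      simp only [hper, hg]; ring
    have hy' : g (w y) = g y := by
      have h1 := Int.emod_nonneg (y - 1) (show (N : ℤ) ≠ 0 by omega)
      have h2 := Int.emod_lt_of_pos (y - 1) hN'
      have h3 := heq ((y - 1) % N + 1) (Finset.mem_Icc.2 (by omega))
      have h4 := hgk.int_mul ((y - 1) / N) ((y - 1) % N + 1)
      have h5 := Int.emod_add_mul_ediv (y - 1) N
      simp only [Int.cast_id] at h4
      rw [show (y - 1) % N + 1 + (y - 1) / N * N = y by linarith] at h4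
      omega
    have h1 : 0 ≤ g y := Int.ediv_nonneg (by omega) hN'.le
    have h2 : g (w y) < 0 := Int.ediv_neg_of_neg_of_pos (by omega) hN'
    omega
  cases t
  · exact fin fun z hz => by have := hz.1; omega
  · exact fin fun z hz => hz.2.1
  · exact per n hn hw.2.1 hw.2.2
  · refine per (2 * (n + 1)) (by omega) (fun z => by simpa [period] using apply_add_period hw z) ?_
    have hs : ∀ z, w (2 * (n + 1) - z) = 2 * (n + 1) - w z := hw.2.2
    rw [← sub_eq_zero, ← Finset.sum_sub_distrib]
    have hlast : w (2 * (n + 1)) = 2 * (n + 1) :=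
      apply_frozen hw (by simp [unfrozen])
    push_cast
    rw [← Finset.insert_Icc_sub_one_right_eq_Icc (by omega), Finset.sum_insert (by simp), hlast,
      sub_self, zero_add]
    have h : ∑ z ∈ Finset.Icc (1 : ℤ) (2 * (n + 1) - 1), (w z - z) =
        ∑ z ∈ Finset.Icc (1 : ℤ) (2 * (n + 1) - 1), -(w z - z) := by
      refine Finset.sum_nbij' (fun z => 2 * (n + 1) - z) (fun z => 2 * (n + 1) - z) ?_ ?_ ?_ ?_ ?_
      · intro z; simp only [Finset.mem_Icc]; omega
      · intro z; simp only [Finset.mem_Icc]; omega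
      · intro z _; ring
      · intro z _; ring
      · intro z _; rw [hs]; ring
    rw [Finset.sum_neg_distrib] at h
    omega

/-- The upward statement applied to $w^{-1}$, whose crossings run in the opposite direction. -/
theorem exists_crossing_down (hn : 1 ≤ n) (hw : w ∈ t.group n) {x y : ℤ} (hy : y ≤ x)
    (hwy : x < w y) : ∃ z, x < z ∧ w z ≤ x := by
  obtain ⟨z, hz, hz'⟩ := exists_crossing_up (t := t) hn (inv_mem hw) hwy
    ((w.symm_apply_apply y).le.trans hy)
  exact ⟨w⁻¹ z, hz', (w.apply_symm_apply z).le.trans hz⟩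

end GeorgeType

/-! ### Gains, inversions and the pattern 321 -/

namespace GeorgeType

variable {t : GeorgeType} {n : ℕ} {v w : Equiv.Perm ℤ} {i : ℕ} {x y z : ℤ}

theorem right_eq_left_add (hn : 1 ≤ n) (hi : t.IsLetter n i) :
    t.right n i = t.left n i + 1 ∨ (t.IsSymm ∧ t.right n i = t.left n i + 2 ∧
      t.left n i + 1 ∉ t.unfrozen n ∧ t.period n ∣ t.left n i + t.right n i) :=
  (window_sum hn hi (fun _ => 0) (fun _ => rfl) (fun _ _ => rfl) (fun _ _ _ => rfl)).imp
    (fun h => h.1) fun h => ⟨h.1, h.2.1, h.2.2.1, h.2.2.2.1⟩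

/-- Under this divisibility `right` is the mirror image of `left` up to the period. So at a
reflection one of the two values determines the other. -/
theorem apply_left_add_apply_right (hw : w ∈ t.group n) (ht : t.IsSymm)
    (h : t.period n ∣ t.left n i + t.right n i) :
    w (t.left n i) + w (t.right n i) = t.left n i + t.right n i := by
  obtain ⟨k, hk⟩ := h
  have h1 : t.right n i = -t.left n i + k * t.period n := by linarith
  rw [h1, apply_add_mul_period hw, apply_neg hw ht]
  ring

/-- Multiplication by the generator `s_i` moves the two values swapped by it away from
their positions. -/
def Gain (t : GeorgeType) (n : ℕ) (v : Equiv.Perm ℤ) (i : ℕ) : Prop :=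
  v (t.left n i) ≤ t.left n i ∧ t.right n i ≤ v (t.right n i)

/-- `w` contains the pattern `321` at unfrozen positions. -/
def Has321 (t : GeorgeType) (n : ℕ) (w : Equiv.Perm ℤ) : Prop :=
  ∃ x y z, x ∈ t.unfrozen n ∧ y ∈ t.unfrozen n ∧ z ∈ t.unfrozen n ∧
    x < y ∧ y < z ∧ w z < w y ∧ w y < w x

theorem globallyContains_pattern321 : t.GloballyContains n w pattern321 ↔ t.Has321 n w := by
  constructor
  · rintro ⟨x, hx, hU, h⟩
    exact ⟨x 0, x 1, x 2, hU 0, hU 1, hU 2, hx (by decide), hx (by decide),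
      (h 2 1).2 (by decide), (h 1 0).2 (by decide)⟩
  · rintro ⟨x, y, z, hx, hy, hz, hxy, hyz, h1, h2⟩
    refine ⟨![x, y, z], ?_, ?_, ?_⟩
    · rw [Fin.strictMono_iff_lt_succ]
      intro a
      fin_cases a <;> simp [hxy, hyz]
    · intro a
      fin_cases a <;> simp [hx, hy, hz]
    · intro a b
      fin_cases a <;> fin_cases b <;> simp [pattern321] <;> omega

theorem abs_sub_add_one (y a : ℤ) : |y - (a + 1)| - |y - a| = if y ≤ a then 1 else -1 := by
  split_ifs with h
  · rw [abs_of_nonpos (by omega), abs_of_nonpos (by omega)]; ring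
  · rw [abs_of_nonneg (by omega), abs_of_nonneg (by omega)]; ring

/-- Moving a value by one position changes its displacement by $\pm1$. An ordinary generator moves
two values by one position each; at a reflection the window sees one value moved by two positions.
Either way $+2$ requires both signs to be positive. -/
theorem disarray_mul_simple (hn : 1 ≤ n) (hi : t.IsLetter n i) (hv : v ∈ t.group n) :
    disarray n (v * t.simple n i) ≤ disarray n v + 2 ∧
      (disarray n (v * t.simple n i) = disarray n v + 2 ↔ t.Gain n v i) := by
  have hvs := mul_mem hv (simple_mem_group hn hi)
  have h := window_sum hn hi (fun x => |(v * t.simple n i) x - x| - |v x - x|)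
    (fun x => by
      simp only [apply_add_period hv, apply_add_period hvs, add_sub_add_right_eq_sub])
    (fun ht x => by
      simp only [apply_neg hv ht, apply_neg hvs ht, sub_neg_eq_add, neg_add_eq_sub]
      rw [abs_sub_comm, abs_sub_comm x])
    (fun x hx hx' => by simp [Equiv.Perm.mul_apply, simple_fixed hn hi hx hx'])
  simp only [Finset.sum_sub_distrib, Equiv.Perm.mul_apply, simple_left hn hi,
    simple_right hn hi] at h
  simp only [disarray, Gain, Equiv.Perm.mul_apply]
  set a := t.left n i
  set b := t.right n i
  rcases h with ⟨hb, h⟩ | ⟨ht, hb, -, hN, -, h⟩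
  · have h1 := abs_sub_add_one (v a) a
    have h2 := abs_sub_add_one (v b) a
    rw [← hb] at h1 h2
    split_ifs at h1 h2 <;> omega
  · have h1 := apply_left_add_apply_right hv ht hN
    have h2 : v b - a = -(v a - (a + 1 + 1)) := by simp only [a, b] at *; linarith
    rw [h2, abs_neg] at h
    have h3 := abs_sub_add_one (v a) a
    have h4 := abs_sub_add_one (v a) (a + 1)
    have h5 : v a + v b = a + b := h1
    split_ifs at h3 h4 <;> omega

/-- The sum of the squared displacements over the window. -/
noncomputable def sqDisarray (n : ℕ) (w : Equiv.Perm ℤ) : ℤ :=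
  ∑ x ∈ Finset.Icc (1 : ℤ) n, (w x - x) ^ 2

theorem sqDisarray_nonneg : 0 ≤ sqDisarray n w :=
  Finset.sum_nonneg fun _ _ => sq_nonneg _

/-- The sum changes by $2(v(b)-v(a))$ in both shapes. It serves as the termination measure because
the disarray itself need not drop at a descent when a $321$ is present. -/
theorem sqDisarray_mul_simple_lt (hn : 1 ≤ n) (hi : t.IsLetter n i) (hv : v ∈ t.group n)
    (hlt : v (t.right n i) < v (t.left n i)) :
    sqDisarray n (v * t.simple n i) < sqDisarray n v := by
  have hvs := mul_mem hv (simple_mem_group hn hi)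
  have h := window_sum hn hi (fun x => ((v * t.simple n i) x - x) ^ 2 - (v x - x) ^ 2)
    (fun x => by
      simp only [apply_add_period hv, apply_add_period hvs, add_sub_add_right_eq_sub])
    (fun ht x => by simp only [apply_neg hv ht, apply_neg hvs ht]; ring)
    (fun x hx hx' => by simp [Equiv.Perm.mul_apply, simple_fixed hn hi hx hx'])
  simp only [Finset.sum_sub_distrib, Equiv.Perm.mul_apply, simple_left hn hi,
    simple_right hn hi] at h
  simp only [sqDisarray, Equiv.Perm.mul_apply]
  rcases h with ⟨hb, h⟩ | ⟨ht, hb, -, hN, -, h⟩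
  · have : ∀ p q a b : ℤ, b = a + 1 →
        (q - a) ^ 2 - (p - a) ^ 2 + ((p - b) ^ 2 - (q - b) ^ 2) = 2 * (q - p) := by
      rintro p q a b rfl; ring
    rw [this _ _ _ _ hb] at h
    linarith
  · have h1 := apply_left_add_apply_right hv ht hN
    have : ∀ p q a b : ℤ, b = a + 2 → p + q = a + b →
        (q - a) ^ 2 - (p - a) ^ 2 = 2 * (q - p) := by
      rintro p q a b rfl h
      obtain rfl : q = a + (a + 2) - p := by linarith
      ring
    rw [this _ _ _ _ hb h1] at h
    linarith

/-- Every point moved up is a translate of `left` or of the negative of `right`; both possibilities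
carry statements about the pair `left`, `right` to all its images. -/
theorem up_cases (hx : t.Up n i x) :
    ∃ k : ℤ,
      (x = t.left n i + k * t.period n ∧ ∀ v ∈ t.group n,
        v x = v (t.left n i) + k * t.period n ∧
        v (x + (t.right n i - t.left n i)) = v (t.right n i) + k * t.period n) ∨
      (t.IsSymm ∧ x = -t.right n i + k * t.period n ∧ ∀ v ∈ t.group n,
        v x = -v (t.right n i) + k * t.period n ∧
        v (x + (t.right n i - t.left n i)) = -v (t.left n i) + k * t.period n) := by
  rcases hx with ⟨k, hk⟩ | ⟨ht, k, hk⟩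
  · refine ⟨k, Or.inl ⟨by linarith, fun v hv => ?_⟩⟩
    rw [show x + (t.right n i - t.left n i) = t.right n i + k * t.period n by linarith,
      show x = t.left n i + k * t.period n by linarith, apply_add_mul_period hv,
      apply_add_mul_period hv]
    exact ⟨rfl, rfl⟩
  · refine ⟨k, Or.inr ⟨ht, by linarith, fun v hv => ?_⟩⟩
    rw [show x + (t.right n i - t.left n i) = -t.left n i + k * t.period n by linarith,
      show x = -t.right n i + k * t.period n by linarith, apply_add_mul_period hv,
      apply_add_mul_period hv, apply_neg hv ht, apply_neg hv ht]
    exact ⟨rfl, rfl⟩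

theorem lt_iff_of_up (hv : v ∈ t.group n) (hx : t.Up n i x) :
    v x < v (x + (t.right n i - t.left n i)) ↔ v (t.left n i) < v (t.right n i) := by
  obtain ⟨k, ⟨-, h⟩ | ⟨-, -, h⟩⟩ := up_cases hx
  · rw [(h v hv).1, (h v hv).2]; omega
  · rw [(h v hv).1, (h v hv).2]; omega

theorem Gain.of_up (h : t.Gain n v i) (hv : v ∈ t.group n) (hx : t.Up n i x) :
    v x ≤ x ∧
      x + (t.right n i - t.left n i) ≤ v (x + (t.right n i - t.left n i)) := by
  obtain ⟨h1, h2⟩ := h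
  obtain ⟨k, ⟨hk, h⟩ | ⟨-, hk, h⟩⟩ := up_cases hx
  · rw [(h v hv).1, (h v hv).2]; omega
  · rw [(h v hv).1, (h v hv).2]; omega

theorem add_one_frozen_of_up (hx : t.Up n i x) (ht : t.IsSymm)
    (hb : t.right n i = t.left n i + 2) (ha : t.left n i + 1 ∉ t.unfrozen n) :
    x + 1 ∉ t.unfrozen n := by
  obtain ⟨k, ⟨hk, -⟩ | ⟨-, hk, -⟩⟩ := up_cases hx
  · rwa [hk, add_right_comm, unfrozen_add_mul_period]
  · rwa [hk, add_right_comm, unfrozen_add_mul_period, ← unfrozen_neg ht,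
      show -(-t.right n i + 1) = t.left n i + 1 by linarith]

/-- Restricting to unfrozen positions is essential: a reflection also inverts each swapped point
with the frozen centre between them. -/
theorem up_of_inversion (hn : 1 ≤ n) (hi : t.IsLetter n i) (hx : x ∈ t.unfrozen n)
    (hy : y ∈ t.unfrozen n) (hxy : x < y) (h : t.simple n i y < t.simple n i x) :
    t.Up n i x ∧ y = x + (t.right n i - t.left n i) := by
  have cases : ∀ z, (t.Up n i z ∧ t.simple n i z = z + (t.right n i - t.left n i)) ∨
      (t.Down n i z ∧ t.simple n i z = z - (t.right n i - t.left n i)) ∨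
      t.simple n i z = z := by
    intro z
    by_cases h : t.Up n i z
    · exact Or.inl ⟨h, simple_up hn hi h⟩
    by_cases h' : t.Down n i z
    · exact Or.inr (Or.inl ⟨h', simple_down hn hi h'⟩)
    · exact Or.inr (Or.inr (simple_fixed hn hi h h'))
  rcases right_eq_left_add hn hi with hb | ⟨ht, hb, ha, -⟩
  · rcases cases x with ⟨h1, h2⟩ | ⟨h1, h2⟩ | h2 <;>
      rcases cases y with ⟨h3, h4⟩ | ⟨h3, h4⟩ | h4 <;>
      first | exact ⟨h1, by omega⟩ | (exfalso; omega)
  · have hup : ∀ z, t.Up n i z → z + 1 ∉ t.unfrozen n := fun z hz =>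
      add_one_frozen_of_up hz ht hb ha
    have hdown : ∀ z, t.Down n i z → z - 1 ∉ t.unfrozen n := fun z hz => by
      have := hup _ (up_of_down hz)
      rwa [hb, show z - (t.left n i + 2 - t.left n i) + 1 = z - 1 by ring] at this
    have ne_up : ∀ z u, t.Up n i z → u ∈ t.unfrozen n → u ≠ z + 1 := fun z u hz hu h =>
      hup z hz (h ▸ hu)
    have ne_down : ∀ z u, t.Down n i z → u ∈ t.unfrozen n → u ≠ z - 1 := fun z u hz hu h =>
      hdown z hz (h ▸ hu)
    rcases cases x with ⟨h1, h2⟩ | ⟨h1, h2⟩ | h2 <;>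
      rcases cases y with ⟨h3, h4⟩ | ⟨h3, h4⟩ | h4
    · exfalso; omega
    · have := ne_up x y h1 hy
      have := ne_down y x h3 hx
      have := ne_up x _ h1 (apply_unfrozen (simple_mem_group hn hi) hy)
      exact ⟨h1, by omega⟩
    · have := ne_up x y h1 hy
      exfalso; omega
    · exfalso; omega
    · exfalso; omega
    · exfalso; omega
    · exfalso; omega
    · have := ne_down y x h3 hx
      exfalso; omega
    · exfalso; omega

theorem frozen_of_up_of_between (hn : 1 ≤ n) (hi : t.IsLetter n i) (hx : t.Up n i x)
    (h1 : x < y) (h2 : y < x + (t.right n i - t.left n i)) : y ∉ t.unfrozen n := by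
  rcases right_eq_left_add hn hi with hb | ⟨ht, hb, ha, -⟩
  · omega
  · obtain rfl : y = x + 1 := by omega
    exact add_one_frozen_of_up hx ht hb ha

theorem simple_lt_simple (hn : 1 ≤ n) (hi : t.IsLetter n i) (hx : x ∈ t.unfrozen n)
    (hy : y ∈ t.unfrozen n) (hxy : x < y)
    (h : ¬ (t.Up n i x ∧ y = x + (t.right n i - t.left n i))) :
    t.simple n i x < t.simple n i y := by
  by_contra h'
  refine h (up_of_inversion hn hi hx hy hxy (lt_of_le_of_ne (not_lt.1 h') fun e => ?_))
  exact hxy.ne' ((t.simple n i).injective e)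

/-- At an ascent, the pairs whose order $s_i$ reverses are not inversions of $v$, so $s_i$ carries
the three positions of a $321$ to positions in the same order. -/
theorem Has321.mul_simple (h : t.Has321 n v) (hn : 1 ≤ n) (hi : t.IsLetter n i)
    (hv : v ∈ t.group n) (hlt : v (t.left n i) < v (t.right n i)) :
    t.Has321 n (v * t.simple n i) := by
  obtain ⟨x, y, z, hx, hy, hz, hxy, hyz, h1, h2⟩ := h
  have hs := simple_mem_group hn hi
  have key : ∀ p q, p ∈ t.unfrozen n → q ∈ t.unfrozen n → p < q → v q < v p →
      t.simple n i p < t.simple n i q := by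
    intro p q hp hq hpq hvpq
    refine simple_lt_simple hn hi hp hq hpq ?_
    rintro ⟨hup, rfl⟩
    exact hvpq.asymm ((lt_iff_of_up hv hup).2 hlt)
  refine ⟨_, _, _, apply_unfrozen hs hx, apply_unfrozen hs hy, apply_unfrozen hs hz,
    key x y hx hy hxy h2, key y z hy hz hyz h1, ?_, ?_⟩
  · simpa only [Equiv.Perm.mul_apply, simple_simple hn hi]
  · simpa only [Equiv.Perm.mul_apply, simple_simple hn hi]

/-- A $321$ in $vs_i$ pulls back to $v$ unless two consecutive members of it are a pair swapped by
$s_i$. In that case the gain places values so that a cut next to the pair is crossed, and the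
opposite crossing replaces the lost member. -/
theorem Gain.not_has321 (hg : t.Gain n v i) (hn : 1 ≤ n) (hi : t.IsLetter n i)
    (hv : v ∈ t.group n) (h : ¬ t.Has321 n v) : ¬ t.Has321 n (v * t.simple n i) := by
  rintro ⟨x, y, z, hx, hy, hz, hxy, hyz, h1, h2⟩
  apply h
  have hs := simple_mem_group hn hi
  simp only [Equiv.Perm.mul_apply] at h1 h2
  by_cases hA : t.Up n i x ∧ y = x + (t.right n i - t.left n i)
  · have hzx := simple_lt_simple hn hi hx hz (hxy.trans hyz) (fun hB => by omega)
    have hg' := hg.of_up hv hA.1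
    have sx := simple_up hn hi hA.1
    rw [← hA.2] at hg' sx
    have sy : t.simple n i y = x := by rw [← sx, simple_simple hn hi]
    rw [sx, sy] at h2
    rw [sx] at hzx
    rw [sy] at h1
    -- The third position lies beyond $x$ but its value is at most $v(x)\le x$. The point $u$
    -- crossing back satisfies $v(u)>x\ge v(x)$, so $u$, $x$, $s_i(z)$ carry a $321$ in $v$.
    obtain ⟨u, hu, hu'⟩ := exists_crossing_up hn hv (hxy.trans hzx)
      (h1.le.trans hg'.1)
    have hux : u ≠ x := by rintro rfl; omega
    exact ⟨u, x, _, unfrozen_of_ne hv (by omega), hx, apply_unfrozen hs hz, by omega, by omega,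
      h1, by omega⟩
  by_cases hB : t.Up n i y ∧ z = y + (t.right n i - t.left n i)
  · have hzx := simple_lt_simple hn hi hx hz (hxy.trans hyz) (fun hC =>
      frozen_of_up_of_between hn hi hC.1 hxy (by omega) hy)
    have hg' := hg.of_up hv hB.1
    have sy := simple_up hn hi hB.1
    rw [← hB.2] at hg' sy
    have sz : t.simple n i z = y := by rw [← sy, simple_simple hn hi]
    rw [sz] at hzx h1
    rw [sy] at h2
    obtain ⟨u, hu, hu'⟩ := exists_crossing_down hn hv (x := z - 1) (y := t.simple n i x)
      (by omega) (by omega)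
    have huz : u ≠ z := by rintro rfl; omega
    exact ⟨_, z, u, apply_unfrozen hs hx, hz, unfrozen_of_ne hv (by omega), by omega, by omega,
      by omega, h2⟩
  exact ⟨_, _, _, apply_unfrozen hs hx, apply_unfrozen hs hy, apply_unfrozen hs hz,
    simple_lt_simple hn hi hx hy hxy hA, simple_lt_simple hn hi hy hz hyz hB, h1, h2⟩

/-! ### Descents -/

theorem le_left_or_right_le (hn : 1 ≤ n) (hi : t.IsLetter n i) (hx : x ∈ t.unfrozen n) :
    x ≤ t.left n i ∨ t.right n i ≤ x := by
  by_contra! h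
  exact frozen_of_up_of_between hn hi up_left h.1 (by omega) hx

/-- If $w(b)>a$, then $w(a)>w(b)\ge b$ crosses the cut just below $b$ upward, and the returning
value, at a position beyond $b$, completes a $321$ with $a$ and $b$. The other inequality is the
mirror image. -/
theorem gain_mul_simple_of_descent (hn : 1 ≤ n) (hi : t.IsLetter n i) (hw : w ∈ t.group n)
    (h : ¬ t.Has321 n w) (hlt : w (t.right n i) < w (t.left n i)) :
    t.Gain n (w * t.simple n i) i := by
  simp only [Gain, Equiv.Perm.mul_apply, simple_left hn hi, simple_right hn hi]
  have ha := left_mem_unfrozen hn hi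
  have hb := right_mem_unfrozen hn hi
  have hab := left_lt_right hn hi
  constructor
  · by_contra h1
    have h2 := (le_left_or_right_le hn hi (apply_unfrozen hw hb)).resolve_left h1
    obtain ⟨u, hu, hu'⟩ := exists_crossing_down hn hw (x := t.right n i - 1) (y := t.left n i)
      (by omega) (by omega)
    have hub : u ≠ t.right n i := by rintro rfl; omega
    exact h ⟨_, _, u, ha, hb, unfrozen_of_ne hw (by omega), hab, by omega, by omega, hlt⟩
  · by_contra h1
    have h2 := (le_left_or_right_le hn hi (apply_unfrozen hw ha)).resolve_right h1
    obtain ⟨u, hu, hu'⟩ := exists_crossing_up hn hw (x := t.left n i) (y := t.right n i)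
      (by omega) (by omega)
    have hua : u ≠ t.left n i := by rintro rfl; omega
    exact h ⟨u, _, _, unfrozen_of_ne hw (by omega), ha, hb, by omega, hab, hlt, by omega⟩

theorem exists_inversion (hn : 1 ≤ n) (hw : w ∈ t.group n) (h : w ≠ 1) :
    ∃ x y, x ∈ t.unfrozen n ∧ y ∈ t.unfrozen n ∧ x < y ∧ w y < w x := by
  obtain ⟨x, hx⟩ : ∃ x, w x ≠ x := by
    by_contra! h'
    exact h (Equiv.ext h')
  have hU := unfrozen_of_ne hw hx
  rcases lt_or_gt_of_ne hx with h1 | h1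
  · obtain ⟨z, hz, hz'⟩ := exists_crossing_up hn hw (x := x - 1) (y := x) (by omega) (by omega)
    exact ⟨z, x, unfrozen_of_ne hw (by omega), hU, by omega, by omega⟩
  · obtain ⟨z, hz, hz'⟩ := exists_crossing_down hn hw (x := x) (y := x) le_rfl h1
    exact ⟨x, z, hU, unfrozen_of_ne hw (by omega), by omega, by omega⟩

theorem exists_adjacent_inversion (hx : x ∈ t.unfrozen n) (hy : y ∈ t.unfrozen n)
    (hxy : x < y) (h : w y < w x) :
    ∃ x y, x ∈ t.unfrozen n ∧ y ∈ t.unfrozen n ∧ x < y ∧ w y < w x ∧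
      ∀ z, x < z → z < y → z ∉ t.unfrozen n := by
  induction hk : (y - x).toNat using Nat.strong_induction_on generalizing x y with
  | _ k ih =>
    by_cases hz : ∃ z, x < z ∧ z < y ∧ z ∈ t.unfrozen n
    · obtain ⟨z, hxz, hzy, hz⟩ := hz
      by_cases hwz : w z < w x
      · exact ih _ (by omega) hx hz hxz hwz rfl
      · exact ih _ (by omega) hz hy hzy (by omega) rfl
    · push Not at hz
      exact ⟨x, y, hx, hy, hxy, h, hz⟩

/-- The trivial affine group with $n=1$ has no generators and is the only exception. In affine
$S^C_n$ the index is read off the residue of $x$ modulo $2(n+1)$, the upper half being the mirror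
image of the lower. -/
theorem exists_up_of_adjacent (hn : 1 ≤ n) (hx : x ∈ t.unfrozen n) (hy : y ∈ t.unfrozen n)
    (hxy : x < y) (h : ∀ z, x < z → z < y → z ∉ t.unfrozen n) :
    (t = affS ∧ n = 1 ∧ y = x + 1) ∨
      ∃ i, t.IsLetter n i ∧ t.Up n i x ∧ y = x + (t.right n i - t.left n i) := by
  have step : x + 1 ∈ t.unfrozen n → y = x + 1 := fun h1 => by
    by_contra h2
    exact h (x + 1) (by omega) (by omega) h1
  have step2 : x + 1 ∉ t.unfrozen n → x + 2 ∈ t.unfrozen n → y = x + 2 := fun h1 h2 => by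
    by_contra h3
    by_cases h4 : y = x + 1
    · exact h1 (h4 ▸ hy)
    · exact h (x + 2) (by omega) (by omega) h2
  cases t
  · right
    have h1 := hx.1
    have h2 := hy.2
    have := step ⟨by omega, by omega⟩
    exact ⟨x.toNat, ⟨by omega, by omega⟩, by simp [Up, left, period, IsSymm]; omega,
      by simp [right, left]; omega⟩
  · right
    obtain ⟨hx0, hx1, hx2⟩ := hx
    obtain ⟨hy0, hy1, hy2⟩ := hy
    rcases lt_trichotomy x (-1) with h1 | rfl | h1
    · have := step ⟨by omega, by omega, by omega⟩
      have h2 : (-y).toNat ≠ 0 := by omega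
      exact ⟨(-y).toNat, by simp only [IsLetter]; omega,
        by simp [Up, left, right, period, IsSymm, h2]; omega, by simp [right, left, h2]; omega⟩
    · have := step2 (by simp [unfrozen]) (by simp [unfrozen]; omega)
      exact ⟨0, by simp only [IsLetter]; omega, by simp [Up, left],
        by simp [right, left]; omega⟩
    · have := step ⟨by omega, by omega, by omega⟩
      have h2 : x.toNat ≠ 0 := by omega
      exact ⟨x.toNat, by simp only [IsLetter]; omega,
        by simp [Up, left, right, period, IsSymm, h2]; omega, by simp [right, left, h2]; omega⟩
  · have := step trivial
    by_cases hn1 : n = 1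
    · exact Or.inl ⟨rfl, hn1, this⟩
    · right
      have h1 := Int.emod_nonneg x (show (n : ℤ) ≠ 0 by omega)
      have h2 := Int.emod_lt_of_pos x (show (0 : ℤ) < n by omega)
      refine ⟨(x % n).toNat, ⟨by omega, by omega⟩, Or.inl ?_, by simp [right, left, this]⟩
      simp only [left, period, Int.toNat_of_nonneg h1]
      exact Int.dvd_self_sub_emod
  · right
    have h1 := Int.emod_nonneg x (show 2 * ((n : ℤ) + 1) ≠ 0 by omega)
    have h2 := Int.emod_lt_of_pos x (show (0 : ℤ) < 2 * ((n : ℤ) + 1) by omega)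
    have h3 := Int.emod_add_mul_ediv x (2 * ((n : ℤ) + 1))
    set r := x % (2 * ((n : ℤ) + 1))
    set q := x / (2 * ((n : ℤ) + 1))
    have hU : ∀ c, x + c ∈ affSC.unfrozen n ↔ r + c ∈ affSC.unfrozen n := by
      intro c
      rw [← unfrozen_add_mul_period (r + c) q]
      simp only [period]
      rw [show x + c = r + c + q * (2 * (n + 1)) by linarith]
    have hr : r ∈ affSC.unfrozen n := by simpa using (hU 0).1 (by simpa using hx)
    have hr0 : r ≠ 0 := by intro h; simp [h, unfrozen] at hr
    have hr1 : r ≠ n + 1 := by intro h; simp [h, unfrozen] at hr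
    have small : ∀ c : ℤ, 0 < c → c < n + 1 → c ∈ affSC.unfrozen n := fun c h h' =>
      not_dvd_of_small (by omega) (by omega)
    have big : ∀ c : ℤ, n + 1 < c → c < 2 * (n + 1) → c ∈ affSC.unfrozen n := fun c h h' =>
      not_dvd_of_dvd (dvd_refl _) (by omega) (by omega)
    have hd : ∀ c : ℤ, affSC.period n ∣ x - c ↔ affSC.period n ∣ r - c := by
      intro c
      simp only [period]
      rw [show x - c = r - c + (2 * (n + 1)) * q by linarith]
      exact dvd_add_left ⟨q, rfl⟩
    rcases lt_trichotomy r n with h4 | h4 | h4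
    · have := step ((hU 1).2 (small _ (by omega) (by omega)))
      have h5 : r.toNat ≠ 0 := by omega
      have h6 : r.toNat ≠ n := by omega
      refine ⟨r.toNat, by simp only [IsLetter]; omega, Or.inl ?_, ?_⟩
      · rw [hd]
        simp only [left, h5, if_false, Int.toNat_of_nonneg h1, sub_self, dvd_zero]
      · simp only [left, right, h5, h6, if_false]; omega
    · have := step2 (by rw [hU, h4]; simp [unfrozen])
        ((hU 2).2 (big _ (by omega) (by omega)))
      have h5 : n ≠ 0 := by omega
      refine ⟨n, le_refl _, Or.inl ?_, ?_⟩
      · rw [hd]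
        simp only [left, h5, if_false, h4, sub_self, dvd_zero]
      · simp only [left, right, h5, if_false, if_true]; omega
    · by_cases h5 : r = 2 * n + 1
      · have := step2 (by rw [hU, h5]; exact not_not_intro ⟨2, by ring⟩)
          ((unfrozen_iff_of_dvd_sub (y := 1) (by
            simp only [period]
            exact ⟨q + 1, by linarith⟩)).2 (small 1 (by omega) (by omega)))
        have h6 : 0 ≠ n := by omega
        refine ⟨0, Nat.zero_le _, Or.inl ?_, ?_⟩
        · rw [hd]
          simp only [left, if_true, period]
          exact ⟨1, by linarith⟩
        · simp only [left, right, h6, if_false, if_true]; omega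
      · have := step ((hU 1).2 (big _ (by omega) (by omega)))
        have h6 : (2 * (n + 1) - r - 1).toNat ≠ 0 := by omega
        have h7 : (2 * (n + 1) - r - 1).toNat ≠ n := by omega
        refine ⟨(2 * (n + 1) - r - 1).toNat, by simp only [IsLetter]; omega,
          Or.inr ⟨trivial, ?_⟩, ?_⟩
        · rw [← sub_neg_eq_add, hd]
          simp only [right, h7, if_false, period]
          exact ⟨1, by omega⟩
        · simp only [left, right, h6, h7, if_false]; omega

theorem exists_descent (hn : 1 ≤ n) (hw : w ∈ t.group n) (h : w ≠ 1) :
    ∃ i, t.IsLetter n i ∧ w (t.right n i) < w (t.left n i) := by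
  obtain ⟨x, y, hx, hy, hxy, hlt⟩ := exists_inversion hn hw h
  obtain ⟨x, y, hx, hy, hxy, hlt, hU⟩ := exists_adjacent_inversion hx hy hxy hlt
  -- For $n=1$ in the affine family, $w(x+1)=w(x)+1$ rules out an adjacent inversion.
  rcases exists_up_of_adjacent hn hx hy hxy hU with ⟨rfl, rfl, rfl⟩ | ⟨i, hi, hup, rfl⟩
  · have := apply_add_period hw x
    simp only [period, Nat.cast_one] at this
    omega
  · refine ⟨i, hi, lt_of_le_of_ne (not_lt.1 fun h' => ?_) fun h' => ?_⟩
    · exact hlt.asymm ((lt_iff_of_up hw hup).2 h')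
    · exact (left_lt_right hn hi).ne' (w.injective h')

end GeorgeType

/-! ### Words of gains, and the equivalence of (A) and (C) -/

namespace GeorgeType

variable {t : GeorgeType} {n : ℕ} {u v w : Equiv.Perm ℤ} {i k : ℕ} {x : ℤ} {l : List ℕ}

/-- The product of the generators in a word. -/
def wordProd (t : GeorgeType) (n : ℕ) (l : List ℕ) : Equiv.Perm ℤ := (l.map (t.simple n)).prod

@[simp] theorem wordProd_nil : t.wordProd n [] = 1 := rfl

@[simp] theorem wordProd_cons : t.wordProd n (i :: l) = t.simple n i * t.wordProd n l := by
  simp [wordProd]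

@[simp] theorem wordProd_append (l l' : List ℕ) :
    t.wordProd n (l ++ l') = t.wordProd n l * t.wordProd n l' := by
  simp [wordProd]

theorem wordProd_mem_group (hn : 1 ≤ n) (hl : ∀ i ∈ l, t.IsLetter n i) :
    t.wordProd n l ∈ t.group n := by
  refine Subgroup.list_prod_mem _ fun s hs => ?_
  obtain ⟨i, hi, rfl⟩ := List.mem_map.1 hs
  exact simple_mem_group hn (hl i hi)

/-- Every letter of the word `l` is a gain when the word is multiplied onto `u`. -/
def AllGain (t : GeorgeType) (n : ℕ) : Equiv.Perm ℤ → List ℕ → Prop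
  | _, [] => True
  | u, i :: l => t.Gain n u i ∧ AllGain t n (u * t.simple n i) l

theorem allGain_append (l l' : List ℕ) : t.AllGain n u (l ++ l') ↔
    t.AllGain n u l ∧ t.AllGain n (u * t.wordProd n l) l' := by
  induction l generalizing u with
  | nil => simp [AllGain]
  | cons i l ih => simp [AllGain, ih, and_assoc, mul_assoc]

theorem exists_not_gain_of_not_allGain (h : ¬ t.AllGain n u l) :
    ∃ A i B, l = A ++ i :: B ∧ t.AllGain n u A ∧ ¬ t.Gain n (u * t.wordProd n A) i := by
  induction l generalizing u with
  | nil => exact (h trivial).elim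
  | cons i l ih =>
    by_cases hg : t.Gain n u i
    · obtain ⟨A, j, B, rfl, hA, hj⟩ := ih (u := u * t.simple n i) fun h' => h ⟨hg, h'⟩
      exact ⟨i :: A, j, B, rfl, ⟨hg, hA⟩, by rwa [wordProd_cons, ← mul_assoc]⟩
    · exact ⟨[], i, l, rfl, trivial, by simpa⟩

theorem disarray_mul_wordProd (hn : 1 ≤ n) (hl : ∀ i ∈ l, t.IsLetter n i) (hu : u ∈ t.group n) :
    disarray n (u * t.wordProd n l) ≤ disarray n u + 2 * l.length ∧
      (disarray n (u * t.wordProd n l) = disarray n u + 2 * l.length ↔ t.AllGain n u l) := by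
  induction l generalizing u with
  | nil => simp [AllGain]
  | cons i l ih =>
    have hi := hl i List.mem_cons_self
    have h1 := ih (fun j hj => hl j (List.mem_cons_of_mem _ hj))
      (mul_mem hu (simple_mem_group hn hi))
    have h2 := disarray_mul_simple hn hi hu
    rw [wordProd_cons, ← mul_assoc]
    simp only [AllGain, ← h1.2, ← h2.2, List.length_cons]
    push_cast
    omega

theorem disarray_one : disarray n 1 = 0 := by simp [disarray]

theorem disarray_wordProd_le (hn : 1 ≤ n) (hl : ∀ i ∈ l, t.IsLetter n i) :
    disarray n (t.wordProd n l) ≤ 2 * l.length := by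
  simpa [disarray_one] using (disarray_mul_wordProd hn hl (one_mem (t.group n))).1

theorem disarray_wordProd_eq_iff (hn : 1 ≤ n) (hl : ∀ i ∈ l, t.IsLetter n i) :
    disarray n (t.wordProd n l) = 2 * l.length ↔ t.AllGain n 1 l := by
  simpa [disarray_one] using (disarray_mul_wordProd hn hl (one_mem (t.group n))).2

theorem AllGain.not_has321 (h : t.AllGain n u l) (hn : 1 ≤ n) (hl : ∀ i ∈ l, t.IsLetter n i)
    (hu : u ∈ t.group n) (hu' : ¬ t.Has321 n u) : ¬ t.Has321 n (u * t.wordProd n l) := by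
  induction l generalizing u with
  | nil => simpa
  | cons i l ih =>
    have hi := hl i List.mem_cons_self
    rw [wordProd_cons, ← mul_assoc]
    exact ih h.2 (fun j hj => hl j (List.mem_cons_of_mem _ hj))
      (mul_mem hu (simple_mem_group hn hi)) (h.1.not_has321 hn hi hu hu')

theorem not_has321_one : ¬ t.Has321 n 1 := by
  rintro ⟨x, y, z, -, -, -, h1, h2, h3, h4⟩
  simp only [Equiv.Perm.one_apply] at h3 h4
  omega

/-- Every element of the group is a product of generators; if it avoids `321`, the number of
generators can be taken to be half the disarray. -/
theorem exists_word (hn : 1 ≤ n) (hw : w ∈ t.group n) :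
    ∃ l, t.IsWord n w l ∧ (¬ t.Has321 n w → disarray n w = 2 * l.length) := by
  induction hk : (sqDisarray n w).toNat using Nat.strong_induction_on generalizing w with
  | _ k ih =>
    by_cases h1 : w = 1
    · subst h1
      exact ⟨[], ⟨by simp, rfl⟩, fun _ => by simp [disarray_one]⟩
    obtain ⟨i, hi, hlt⟩ := exists_descent hn hw h1
    have hv := mul_mem hw (simple_mem_group hn hi)
    have hss : w * t.simple n i * t.simple n i = w := by
      rw [mul_assoc, simple_mul_simple hn hi, mul_one]
    have hsq := sqDisarray_mul_simple_lt hn hi hw hlt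
    have h0 : 0 ≤ sqDisarray n (w * t.simple n i) := sqDisarray_nonneg
    obtain ⟨l, ⟨hl, hprod⟩, hlen⟩ := ih _ (by omega) hv rfl
    refine ⟨l ++ [i], ⟨?_, ?_⟩, fun h321 => ?_⟩
    · intro j hj
      rcases List.mem_append.1 hj with hj | hj
      · exact hl j hj
      · rwa [List.mem_singleton.1 hj]
    · simp [hprod, hss]
    -- When $w$ avoids $321$, the stripped element avoids it too and the last letter is a gain, so
    -- each letter accounts for exactly $2$ of the disarray.
    · have hg := gain_mul_simple_of_descent hn hi hw h321 hlt
      have hd := (disarray_mul_simple hn hi hv).2.2 hg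
      have hlt' : (w * t.simple n i) (t.left n i) < (w * t.simple n i) (t.right n i) := by
        simpa [Equiv.Perm.mul_apply, simple_left hn hi, simple_right hn hi]
      have h321' : ¬ t.Has321 n (w * t.simple n i) := fun h => h321 (by
        have := h.mul_simple hn hi hv hlt'
        rwa [hss] at this)
      rw [hss, hlen h321'] at hd
      rw [hd, List.length_append]
      push_cast
      simp
      ring

theorem coxeterLength_le (h : t.IsWord n w l) : t.coxeterLength n w ≤ l.length :=
  Nat.sInf_le ⟨l, h, rfl⟩

theorem exists_reducedWord (hn : 1 ≤ n) (hw : w ∈ t.group n) : ∃ l, t.IsReducedWord n w l := by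
  obtain ⟨l, hl, -⟩ := exists_word hn hw
  exact Nat.sInf_mem (s := {k | ∃ l : List ℕ, t.IsWord n w l ∧ l.length = k}) ⟨_, l, hl, rfl⟩

theorem IsReducedWord.congr {l' : List ℕ} (h : t.IsReducedWord n w l)
    (hl' : ∀ i ∈ l', t.IsLetter n i) (hp : t.wordProd n l' = t.wordProd n l) :
    l.length ≤ l'.length ∧ (l'.length = l.length → t.IsReducedWord n w l') := by
  have hw : t.IsWord n w l' := ⟨hl', hp.trans h.1.2⟩
  exact ⟨h.2.le.trans (coxeterLength_le hw), fun e => ⟨hw, e.trans h.2⟩⟩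

theorem IsReducedWord.disarray_eq_iff (h : t.IsReducedWord n w l) (hn : 1 ≤ n) :
    disarray n w = 2 * t.coxeterLength n w ↔ t.AllGain n 1 l := by
  rw [← h.2, ← disarray_wordProd_eq_iff hn h.1.1, show t.wordProd n l = w from h.1.2]

theorem disarray_eq_iff_not_has321 (hn : 1 ≤ n) (hw : w ∈ t.group n) :
    disarray n w = 2 * t.coxeterLength n w ↔ ¬ t.Has321 n w := by
  obtain ⟨l, hl⟩ := exists_reducedWord hn hw
  constructor
  · intro h
    have := ((hl.disarray_eq_iff hn).1 h).not_has321 hn hl.1.1 (one_mem _) not_has321_one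
    rwa [one_mul, show t.wordProd n l = w from hl.1.2] at this
  · intro h
    obtain ⟨l', hl', hd⟩ := exists_word hn hw
    have h1 := coxeterLength_le hl'
    have h2 := disarray_wordProd_le hn hl.1.1
    rw [show t.wordProd n l = w from hl.1.2, hl.2] at h2
    have := hd h
    omega

/-! ### Neighbouring letters and commutation -/

/-- The letter before `i`. -/
def pred (t : GeorgeType) (n i : ℕ) : ℕ := if t = affS ∧ i = 0 then n - 1 else i - 1

/-- The letter after `i`. -/
def succ (t : GeorgeType) (n i : ℕ) : ℕ := if t = affS ∧ i + 1 = n then 0 else i + 1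

/-- Turns each congruence between endpoints of generators into finitely many linear cases. -/
theorem dvd_cases {N d : ℤ} (h : N ∣ d) (hN : N = 0 ∨ (d < 2 * N ∧ -d < 2 * N)) :
    d = 0 ∨ d = N ∨ d = -N := by
  obtain ⟨c, rfl⟩ := h
  rcases hN with rfl | ⟨h1, h2⟩
  · simp
  · have h3 : c < 2 := by nlinarith
    have h4 : -2 < c := by nlinarith
    rcases (by omega : c = -1 ∨ c = 0 ∨ c = 1) with rfl | rfl | rfl <;> simp

theorem eq_of_dvd_left_sub_left (hi : t.IsLetter n i) (hk : t.IsLetter n k)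
    (h : t.period n ∣ t.left n i - t.left n k) : i = k := by
  cases t <;> simp only [IsLetter, left, period] at *
  · have := dvd_cases h (by omega); omega
  · split_ifs at h <;> have := dvd_cases h (by omega) <;> omega
  · have := dvd_cases h (by omega); omega
  · split_ifs at h <;> have := dvd_cases h (by omega) <;> omega

theorem eq_of_dvd_right_sub_right (hi : t.IsLetter n i) (hk : t.IsLetter n k)
    (h : t.period n ∣ t.right n i - t.right n k) : i = k := by
  cases t <;> simp only [IsLetter, right, period] at *
  · have := dvd_cases h (by omega); omega
  · have := dvd_cases h (by omega); omega
  · have := dvd_cases h (by omega); omega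
  · split_ifs at h <;> have := dvd_cases h (by omega) <;> omega

/-- The second alternative forces $n=1$: in affine $S^C_1$ the reflections $s_0$ and $s_1$ also meet
around the other side of the period. -/
theorem succ_eq_of_dvd_left_sub_right (hn : 1 ≤ n) (hi : t.IsLetter n i) (hk : t.IsLetter n k)
    (h : t.period n ∣ t.left n i - t.right n k) :
    (k = t.pred n i ∧ i = t.succ n k) ∨
      (t.IsSymm ∧ i = 0 ∧ k = n ∧ k = t.succ n i ∧ i = t.pred n k) := by
  cases t <;>
    simp only [IsLetter, IsSymm, left, right, period, pred, succ, reduceCtorEq, false_and,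
      true_and, if_false, or_false] at *
  · have := dvd_cases h (by omega); omega
  · split_ifs at h <;> have := dvd_cases h (by omega) <;> omega
  · have := dvd_cases h (by omega); split_ifs <;> omega
  · split_ifs at h <;> have := dvd_cases h (by omega) <;> omega

theorem eq_of_dvd_left_add_right (hn : 1 ≤ n) (hi : t.IsLetter n i) (hk : t.IsLetter n k)
    (ht : t.IsSymm) (h : t.period n ∣ t.left n i + t.right n k) : i = k := by
  cases t <;> simp only [IsLetter, left, right, period, IsSymm] at *
  · split_ifs at h <;> have := dvd_cases h (by omega) <;> omega
  · split_ifs at h <;> have := dvd_cases h (by omega) <;> omega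

theorem eq_zero_of_dvd_left_add_left (hn : 1 ≤ n) (hi : t.IsLetter n i) (hk : t.IsLetter n k)
    (ht : t.IsSymm) (h : t.period n ∣ t.left n i + t.left n k) :
    (i = 0 ∧ k = t.succ n i) ∨ (k = 0 ∧ i ≠ 0 ∧ k = t.pred n i) := by
  cases t <;>
    simp only [IsLetter, left, period, IsSymm, pred, succ, reduceCtorEq, false_and,
      if_false] at *
  · split_ifs at h <;> have := dvd_cases h (by omega) <;> omega
  · split_ifs at h <;> have := dvd_cases h (by omega) <;> omega

theorem eq_last_of_dvd_right_add_right (hn : 1 ≤ n) (hi : t.IsLetter n i) (hk : t.IsLetter n k)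
    (ht : t.IsSymm) (h : t.period n ∣ t.right n i + t.right n k) :
    (i = n ∧ k = t.pred n i) ∨ (k = n ∧ i ≠ n ∧ k = t.succ n i) := by
  cases t <;>
    simp only [IsLetter, right, period, IsSymm, pred, succ, reduceCtorEq, false_and,
      if_false] at *
  · have := dvd_cases h (by omega); omega
  · split_ifs at h <;> have := dvd_cases h (by omega) <;> omega

/-- A different generator can move `left` only if one of its endpoints, up to symmetry, coincides
with it; moving it up would force $k=i$. The exceptional case is the reflection at $0$, whose left
point $-1$ is the mirror image of $1$ and so is moved by the letter after it. -/
theorem moves_left (hn : 1 ≤ n) (hi : t.IsLetter n i) (hk : t.IsLetter n k) (hik : k ≠ i)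
    (h : t.simple n k (t.left n i) ≠ t.left n i) :
    (k = t.pred n i ∧ t.Down n k (t.left n i)) ∨ (t.IsSymm ∧ i = 0 ∧ k = t.succ n i) := by
  have h' : t.Up n k (t.left n i) ∨ t.Down n k (t.left n i) := by
    by_contra! h'
    exact h (simple_fixed hn hk h'.1 h'.2)
  rcases h' with (h | ⟨ht, h⟩) | hd
  · exact (hik (eq_of_dvd_left_sub_left hi hk h).symm).elim
  · exact (hik (eq_of_dvd_left_add_right hn hi hk ht h).symm).elim
  · rcases hd with h | ⟨ht, h⟩
    · rcases succ_eq_of_dvd_left_sub_right hn hi hk h with h' | h'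
      · exact Or.inl ⟨h'.1, Or.inl h⟩
      · exact Or.inr ⟨h'.1, h'.2.1, h'.2.2.2.1⟩
    · rcases eq_zero_of_dvd_left_add_left hn hi hk ht h with h' | h'
      · exact Or.inr ⟨ht, h'⟩
      · exact Or.inl ⟨h'.2.2, Or.inr ⟨ht, h⟩⟩

theorem moves_right (hn : 1 ≤ n) (hi : t.IsLetter n i) (hk : t.IsLetter n k) (hik : k ≠ i)
    (h : t.simple n k (t.right n i) ≠ t.right n i) :
    (k = t.succ n i ∧ t.Up n k (t.right n i)) ∨ (t.IsSymm ∧ i = n ∧ k = t.pred n i) := by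
  have h' : t.Up n k (t.right n i) ∨ t.Down n k (t.right n i) := by
    by_contra! h'
    exact h (simple_fixed hn hk h'.1 h'.2)
  rcases h' with hd | h | ⟨ht, h⟩
  · rcases hd with h | ⟨ht, h⟩
    · rcases succ_eq_of_dvd_left_sub_right hn hk hi (dvd_sub_comm.1 h) with h' | h'
      · exact Or.inl ⟨h'.2, Or.inl h⟩
      · exact Or.inr ⟨h'.1, h'.2.2.1, h'.2.2.2.2⟩
    · rcases eq_last_of_dvd_right_add_right hn hi hk ht h with h' | h'
      · exact Or.inr ⟨ht, h'⟩
      · exact Or.inl ⟨h'.2.2, Or.inr ⟨ht, h⟩⟩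
  · exact (hik (eq_of_dvd_right_sub_right hi hk h).symm).elim
  · exact (hik (eq_of_dvd_left_add_right hn hk hi ht (by rwa [add_comm]))).elim

/-- Generators that are not neighbours move disjoint sets of points. -/
theorem commute_simple (hn : 1 ≤ n) (hi : t.IsLetter n i) (hk : t.IsLetter n k) (h1 : k ≠ i)
    (h2 : k ≠ t.pred n i) (h3 : k ≠ t.succ n i) : Commute (t.simple n i) (t.simple n k) := by
  have hs := simple_mem_group hn hk
  have ha : t.simple n k (t.left n i) = t.left n i := by
    by_contra h
    rcases moves_left hn hi hk h1 h with h | h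
    · exact h2 h.1
    · exact h3 h.2.2
  have hb : t.simple n k (t.right n i) = t.right n i := by
    by_contra h
    rcases moves_right hn hi hk h1 h with h | h
    · exact h3 h.1
    · exact h2 h.2.2
  have fix : ∀ x, t.Up n i x → t.simple n k x = x ∧
      t.simple n k (x + (t.right n i - t.left n i)) = x + (t.right n i - t.left n i) := by
    intro x hx
    obtain ⟨c, ⟨hc, h⟩ | ⟨-, hc, h⟩⟩ := up_cases hx
    · rw [(h _ hs).1, (h _ hs).2, ha, hb]; omega
    · rw [(h _ hs).1, (h _ hs).2, ha, hb]; omega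
  refine Equiv.Perm.Disjoint.commute fun x => ?_
  by_cases hu : t.Up n i x
  · exact Or.inr (fix x hu).1
  by_cases hd : t.Down n i x
  · right
    simpa using (fix _ (up_of_down hd)).2
  · exact Or.inl (simple_fixed hn hi hu hd)

/-! ### What must lie between two gains at the same letter -/

theorem Gain.lt_apply_of_up (h : t.Gain n v i) (hn : 1 ≤ n) (hi : t.IsLetter n i)
    (hv : v ∈ t.group n) (hx : t.Up n i x) : x < (v * t.simple n i) x := by
  have := (h.of_up hv hx).2
  have := left_lt_right hn hi
  rw [Equiv.Perm.mul_apply, simple_up hn hi hx]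
  omega

theorem Gain.apply_lt_of_down (h : t.Gain n v i) (hn : 1 ≤ n) (hi : t.IsLetter n i)
    (hv : v ∈ t.group n) (hx : t.Down n i x) : (v * t.simple n i) x < x := by
  have := (h.of_up hv (up_of_down hx)).1
  have := left_lt_right hn hi
  rw [Equiv.Perm.mul_apply, simple_down hn hi hx]
  omega

/-- The letter `i` is not one of the two ends of the diagram of a symmetric group. -/
def IsInner (t : GeorgeType) (n i : ℕ) : Prop := t.IsSymm → i ≠ 0 ∧ i ≠ n

theorem IsInner.pred_of_moves_left (h : t.IsInner n i) (hn : 1 ≤ n) (hi : t.IsLetter n i)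
    (hk : t.IsLetter n k) (hik : k ≠ i) (hm : t.simple n k (t.left n i) ≠ t.left n i) :
    k = t.pred n i ∧ t.Down n k (t.left n i) :=
  (moves_left hn hi hk hik hm).resolve_right fun h' => (h h'.1).1 h'.2.1

theorem IsInner.succ_of_moves_right (h : t.IsInner n i) (hn : 1 ≤ n) (hi : t.IsLetter n i)
    (hk : t.IsLetter n k) (hik : k ≠ i) (hm : t.simple n k (t.right n i) ≠ t.right n i) :
    k = t.succ n i ∧ t.Up n k (t.right n i) :=
  (moves_right hn hi hk hik hm).resolve_right fun h' => (h h'.1).2 h'.2.1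

/-- While the value at `left` is too large, no gain at $i$ is possible, and the only other letter
able to change that value is the preceding one. -/
theorem AllGain.pred_mem {M B : List ℕ} (h : t.AllGain n u (M ++ i :: B)) (hn : 1 ≤ n)
    (hi : t.IsLetter n i) (hin : t.IsInner n i) (hM : ∀ k ∈ M, t.IsLetter n k)
    (hu : t.left n i < u (t.left n i)) : t.pred n i ∈ M := by
  induction M generalizing u with
  | nil => exact absurd h.1.1 (not_le.2 hu)
  | cons k M ih =>
    have hk := hM k List.mem_cons_self
    by_cases hik : k = i
    · subst hik
      exact absurd h.1.1 (not_le.2 hu)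
    by_cases hm : t.simple n k (t.left n i) = t.left n i
    · exact List.mem_cons_of_mem _ (ih h.2 (fun j hj => hM j (List.mem_cons_of_mem _ hj))
        (by rwa [Equiv.Perm.mul_apply, hm]))
    · rw [(hin.pred_of_moves_left hn hi hk hik hm).1]
      exact List.mem_cons_self

theorem AllGain.succ_mem {M B : List ℕ} (h : t.AllGain n u (M ++ i :: B)) (hn : 1 ≤ n)
    (hi : t.IsLetter n i) (hin : t.IsInner n i) (hM : ∀ k ∈ M, t.IsLetter n k)
    (hu : u (t.right n i) < t.right n i) : t.succ n i ∈ M := by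
  induction M generalizing u with
  | nil => exact absurd h.1.2 (not_le.2 hu)
  | cons k M ih =>
    have hk := hM k List.mem_cons_self
    by_cases hik : k = i
    · subst hik
      exact absurd h.1.2 (not_le.2 hu)
    by_cases hm : t.simple n k (t.right n i) = t.right n i
    · exact List.mem_cons_of_mem _ (ih h.2 (fun j hj => hM j (List.mem_cons_of_mem _ hj))
        (by rwa [Equiv.Perm.mul_apply, hm]))
    · rw [(hin.succ_of_moves_right hn hi hk hik hm).1]
      exact List.mem_cons_self

theorem IsInner.down_pred (h : t.IsInner n i) (hi : t.IsLetter n i) :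
    t.Down n (t.pred n i) (t.left n i) := by
  left
  cases t <;>
    simp only [IsInner, IsLetter, IsSymm, left, right, period, pred, reduceCtorEq, false_and,
      true_and, if_false, false_implies, true_implies] at *
  · rw [zero_dvd_iff]; omega
  · rw [zero_dvd_iff, if_neg h.1]; omega
  · split_ifs with h0
    · exact ⟨-1, by omega⟩
    · exact ⟨0, by omega⟩
  · rw [if_neg h.1, if_neg (by omega)]
    exact ⟨0, by omega⟩

theorem IsInner.up_succ (h : t.IsInner n i) (hi : t.IsLetter n i) :
    t.Up n (t.succ n i) (t.right n i) := by
  left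
  cases t <;>
    simp only [IsInner, IsLetter, IsSymm, left, right, period, succ, reduceCtorEq, false_and,
      true_and, if_false, false_implies, true_implies] at *
  · rw [zero_dvd_iff]; omega
  · rw [zero_dvd_iff]; omega
  · split_ifs with h0
    · exact ⟨1, by omega⟩
    · exact ⟨0, by omega⟩
  · rw [if_neg h.2]
    exact ⟨0, by omega⟩

/-- Consider the last letter that moves `left`. A gain at the preceding letter would leave a value
below `left` there, so the letter must be $i$ itself. -/
theorem AllGain.exists_last_of_lt {A : List ℕ} (h : t.AllGain n 1 A) (hn : 1 ≤ n)
    (hi : t.IsLetter n i) (hin : t.IsInner n i) (hA : ∀ k ∈ A, t.IsLetter n k)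
    (hlt : t.left n i < t.wordProd n A (t.left n i)) :
    ∃ A' M, A = A' ++ i :: M ∧ t.pred n i ∉ M := by
  induction A using List.reverseRecOn with
  | nil => simp at hlt
  | append_singleton A k ih =>
    have hk := hA k (by simp)
    have hA' : ∀ j ∈ A, t.IsLetter n j := fun j hj => hA j (by simp [hj])
    by_cases hik : k = i
    · exact ⟨A, [], by simp [hik], by simp⟩
    rw [allGain_append, one_mul] at h
    simp only [wordProd_append, wordProd_cons, wordProd_nil, mul_one] at hlt
    by_cases hkp : k = t.pred n i
    · subst hkp
      have := h.2.1.apply_lt_of_down hn hk (wordProd_mem_group hn hA') (hin.down_pred hi)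
      omega
    · have hm : t.simple n k (t.left n i) = t.left n i := by
        by_contra hm
        exact hkp (hin.pred_of_moves_left hn hi hk hik hm).1
      obtain ⟨A', M, rfl, hM⟩ := ih h.1 hA' (by rwa [Equiv.Perm.mul_apply, hm] at hlt)
      exact ⟨A', M ++ [k], by simp, by simp [hM, Ne.symm hkp]⟩

theorem AllGain.exists_last_of_gt {A : List ℕ} (h : t.AllGain n 1 A) (hn : 1 ≤ n)
    (hi : t.IsLetter n i) (hin : t.IsInner n i) (hA : ∀ k ∈ A, t.IsLetter n k)
    (hlt : t.wordProd n A (t.right n i) < t.right n i) :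
    ∃ A' M, A = A' ++ i :: M ∧ t.succ n i ∉ M := by
  induction A using List.reverseRecOn with
  | nil => simp at hlt
  | append_singleton A k ih =>
    have hk := hA k (by simp)
    have hA' : ∀ j ∈ A, t.IsLetter n j := fun j hj => hA j (by simp [hj])
    by_cases hik : k = i
    · exact ⟨A, [], by simp [hik], by simp⟩
    rw [allGain_append, one_mul] at h
    simp only [wordProd_append, wordProd_cons, wordProd_nil, mul_one] at hlt
    by_cases hkp : k = t.succ n i
    · subst hkp
      have := h.2.1.lt_apply_of_up hn hk (wordProd_mem_group hn hA') (hin.up_succ hi)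
      omega
    · have hm : t.simple n k (t.right n i) = t.right n i := by
        by_contra hm
        exact hkp (hin.succ_of_moves_right hn hi hk hik hm).1
      obtain ⟨A', M, rfl, hM⟩ := ih h.1 hA' (by rwa [Equiv.Perm.mul_apply, hm] at hlt)
      exact ⟨A', M ++ [k], by simp, by simp [hM, Ne.symm hkp]⟩

end GeorgeType

/-! ### Braid moves and triples in reduced words -/

namespace GeorgeType

variable {t : GeorgeType} {n : ℕ} {u v w : Equiv.Perm ℤ} {i k : ℕ} {x : ℤ} {l : List ℕ}

theorem periodicSwap_add_one_congr {N c c' : ℤ} (h : N ∣ c - c') :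
    periodicSwap N c (c + 1) = periodicSwap N c' (c' + 1) := by
  by_cases h1 : N ∣ 1
  · simp [periodicSwap, h1]
  have e : ∀ x, N ∣ x - c ↔ N ∣ x - c' := fun x => by
    rw [show x - c' = x - c + (c - c') by ring, dvd_add_left h]
  have e' : ∀ x, N ∣ x - (c + 1) ↔ N ∣ x - (c' + 1) := fun x => by
    rw [show x - (c' + 1) = x - (c + 1) + (c - c') by ring, dvd_add_left h]
  ext x
  rw [periodicSwap_apply (by simpa), periodicSwap_apply (by simpa)]
  simp [e, e']

/-- For $N\ge3$ the classes of $c$, $c+1$, $c+2$ are distinct, and the two sides are compared on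
each class and off all three. -/
theorem periodicSwap_braid {N : ℤ} (hN : 3 ≤ N) (c : ℤ) :
    periodicSwap N c (c + 1) * periodicSwap N (c + 1) (c + 2) * periodicSwap N c (c + 1) =
      periodicSwap N (c + 1) (c + 2) * periodicSwap N c (c + 1) *
        periodicSwap N (c + 1) (c + 2) := by
  have h1 : ¬ N ∣ c + 1 - c := not_dvd_of_small (by omega) (by omega)
  have h2 : ¬ N ∣ c + 2 - (c + 1) := not_dvd_of_small (by omega) (by omega)
  ext x
  simp only [Equiv.Perm.mul_apply]
  by_cases ha : N ∣ x - c
  · have s1 : ∀ y z : ℤ, y - z = x - c → N ∣ y - z := fun y z h => by rwa [h]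
    have s2 : ∀ y z : ℤ, y - z ≠ x - c → y - z - (x - c) < 3 → x - c - (y - z) < 3 →
        ¬ N ∣ y - z := fun y z h h' h'' => not_dvd_of_dvd ha h (by omega)
    rw [periodicSwap_apply h1 x, if_pos ha, periodicSwap_apply h2 (x + (c + 1 - c)),
      if_pos (s1 _ _ (by ring)), periodicSwap_apply h1, if_neg (s2 _ _ (by omega) (by omega)
      (by omega)), if_neg (s2 _ _ (by omega) (by omega) (by omega)), periodicSwap_apply h2 x,
      if_neg (s2 _ _ (by omega) (by omega) (by omega)),
      if_neg (s2 _ _ (by omega) (by omega) (by omega)), periodicSwap_apply h1 x, if_pos ha,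
      periodicSwap_apply h2, if_pos (s1 _ _ (by ring))]
  by_cases hb : N ∣ x - (c + 1)
  · have s1 : ∀ y z : ℤ, y - z = x - (c + 1) → N ∣ y - z := fun y z h => by rwa [h]
    have s2 : ∀ y z : ℤ, y - z ≠ x - (c + 1) → y - z - (x - (c + 1)) < 3 →
        x - (c + 1) - (y - z) < 3 → ¬ N ∣ y - z := fun y z h h' h'' =>
      not_dvd_of_dvd hb h (by omega)
    rw [periodicSwap_apply h1 x, if_neg ha, if_pos hb, periodicSwap_apply h2 (x - (c + 1 - c)),
      if_neg (s2 _ _ (by omega) (by omega) (by omega)),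
      if_neg (s2 _ _ (by omega) (by omega) (by omega)), periodicSwap_apply h1,
      if_pos (s1 _ _ (by ring)), periodicSwap_apply h2 x, if_pos hb, periodicSwap_apply h1,
      if_neg (s2 _ _ (by omega) (by omega) (by omega)),
      if_neg (s2 _ _ (by omega) (by omega) (by omega)), periodicSwap_apply h2,
      if_neg (s2 _ _ (by omega) (by omega) (by omega)), if_pos (s1 _ _ (by ring))]
    ring
  by_cases hc : N ∣ x - (c + 2)
  · have s1 : ∀ y z : ℤ, y - z = x - (c + 2) → N ∣ y - z := fun y z h => by rwa [h]
    have s2 : ∀ y z : ℤ, y - z ≠ x - (c + 2) → y - z - (x - (c + 2)) < 3 →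
        x - (c + 2) - (y - z) < 3 → ¬ N ∣ y - z := fun y z h h' h'' =>
      not_dvd_of_dvd hc h (by omega)
    rw [periodicSwap_apply h1 x, if_neg ha, if_neg hb, periodicSwap_apply h2 x, if_neg hb,
      if_pos hc, periodicSwap_apply h1 (x - (c + 2 - (c + 1))),
      if_neg (s2 _ _ (by omega) (by omega) (by omega)), if_pos (s1 _ _ (by ring)),
      periodicSwap_apply h2, if_neg (s2 _ _ (by omega) (by omega) (by omega)),
      if_neg (s2 _ _ (by omega) (by omega) (by omega))]
  simp only [periodicSwap_apply h1, periodicSwap_apply h2, ha, hb, hc, if_false]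

theorem affS_braid (hn : 3 ≤ n) :
    affS.simple n i * affS.simple n (affS.succ n i) * affS.simple n i =
      affS.simple n (affS.succ n i) * affS.simple n i * affS.simple n (affS.succ n i) := by
  have h : affS.simple n (affS.succ n i) = periodicSwap n (i + 1) (i + 2) := by
    simp only [simple]
    rw [periodicSwap_add_one_congr (c' := (i : ℤ) + 1), add_assoc]
    · rfl
    · simp only [succ, true_and]
      split_ifs with h
      · exact ⟨-1, by push_cast; omega⟩
      · simp
  rw [h]
  exact periodicSwap_braid (by omega) _

theorem affS_pred_succ : affS.pred n (affS.succ n i) = i := by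
  simp only [pred, succ, true_and]
  by_cases h : i + 1 = n
  · rw [if_pos h, if_pos rfl]
    omega
  · rw [if_neg h, if_neg (by omega)]
    omega

theorem affS_succ_pred (hi : i < n) : affS.succ n (affS.pred n i) = i := by
  simp only [pred, succ, true_and]
  by_cases h : i = 0
  · rw [if_pos h, if_pos (by omega), h]
  · rw [if_neg h, if_neg (by omega)]
    omega

theorem letter_sub_one (hi : t.IsLetter n i) (h : 1 ≤ i) : t.letter n (i - 1) = t.pred n i := by
  cases t <;> simp only [letter, pred, reduceCtorEq, false_and, true_and, if_false]
  rw [if_neg (by omega), Nat.mod_eq_of_lt (by have := hi.2; omega)]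

theorem letter_add_one (hi : t.IsLetter n i) : t.letter n (i + 1) = t.succ n i := by
  cases t <;> simp only [letter, succ, reduceCtorEq, false_and, true_and, if_false]
  have := hi.2
  split_ifs with h
  · rw [h, Nat.mod_self]
  · rw [Nat.mod_eq_of_lt (by omega)]

theorem isLetter_of_mem_window (h1 : 1 ≤ i) (h2 : i ≤ n - 1) : t.IsLetter n i := by
  cases t <;> simp only [IsLetter] <;> omega

theorem isInner_of_mem_window (h1 : 1 ≤ i) (h2 : i ≤ n - 1) : t.IsInner n i :=
  fun _ => by omega

theorem pred_ne_succ (ht : t.Nondegenerate n) (h : 1 ≤ i) : t.pred n i ≠ t.succ n i := by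
  cases t <;> simp only [pred, succ, Nondegenerate, reduceCtorEq, false_and, true_and,
    if_false] at *
  · omega
  · omega
  · split_ifs <;> omega
  · omega

theorem not_reducedWordsAvoidTriples {P Q : List ℕ}
    (hr : t.IsReducedWord n w (P ++ i :: k :: i :: Q)) (h1 : 1 ≤ i) (h2 : i ≤ n - 1)
    (hk : k = t.pred n i ∨ k = t.succ n i) :
    ¬ t.ReducedWordsAvoidTriples n w := by
  intro h
  have hi : t.IsLetter n i := isLetter_of_mem_window h1 h2
  have := h _ hr i h1 h2
  rw [letter_sub_one hi h1, letter_add_one hi] at this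
  have hin : [i, k, i] <:+: P ++ i :: k :: i :: Q := ⟨P, Q, by simp⟩
  rcases hk with rfl | rfl
  · exact this.1 hin
  · exact this.2 hin

/-- Only $i=0$ in affine $S_n$ falls outside the range of (B$'$); there a braid move turns $0\,1\,0$
into $1\,0\,1$, which (B$'$) does forbid. The bound $n\ge3$ is carried along so that small affine
groups, where the two neighbours coincide, also yield a contradiction. -/
theorem not_reducedWordsAvoidTriples_of_succ {P Q : List ℕ}
    (hr : t.IsReducedWord n w (P ++ i :: t.succ n i :: i :: Q)) (hin : t.IsSymm → 1 ≤ i)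
    (hne : t.succ n i ≠ t.pred n i) :
    ¬ t.ReducedWordsAvoidTriples n w ∧ (t = affS → 3 ≤ n) := by
  have hi : t.IsLetter n i := hr.1.1 i (by simp)
  have hk : t.IsLetter n (t.succ n i) := hr.1.1 _ (by simp)
  have h3 : t = affS → 3 ≤ n := by
    rintro rfl
    have h1 := hi.1
    have h2 := hi.2
    simp only [succ, pred, true_and] at hne
    split_ifs at hne <;> omega
  refine ⟨?_, h3⟩
  by_cases h0 : 1 ≤ i
  · refine not_reducedWordsAvoidTriples hr h0 ?_ (Or.inr rfl)
    cases t <;> simp only [IsLetter, succ, reduceCtorEq, false_and, if_false] at * <;> omega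
  · cases t
    · exact (h0 hi.1).elim
    · exact (h0 (hin trivial)).elim
    · have hn := h3 rfl
      have hr' : affS.IsReducedWord n w
          (P ++ affS.succ n i :: i :: affS.succ n i :: Q) := by
        refine (hr.congr (fun j hj => hr.1.1 j ?_) ?_).2 (by simp)
        · simp only [List.mem_append, List.mem_cons] at hj ⊢
          tauto
        · have := affS_braid (i := i) hn
          have h := congrArg (· * affS.wordProd n Q) this
          simp only [mul_assoc] at h
          simp only [wordProd_append, wordProd_cons, h]
      have h1 : affS.succ n i = 1 := by simp only [succ]; rw [if_neg (by omega)]; omega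
      exact not_reducedWordsAvoidTriples hr' (by omega) (by omega)
        (Or.inl affS_pred_succ.symm)
    · exact (h0 (hin trivial)).elim

theorem not_reducedWordsAvoidTriples_of_pred {P Q : List ℕ}
    (hr : t.IsReducedWord n w (P ++ i :: t.pred n i :: i :: Q)) (hin : t.IsSymm → i < n)
    (hne : t.pred n i ≠ t.succ n i) (hne' : t.pred n i ≠ i) :
    ¬ t.ReducedWordsAvoidTriples n w ∧ (t = affS → 3 ≤ n) := by
  have hi : t.IsLetter n i := hr.1.1 i (by simp)
  have hk : t.IsLetter n (t.pred n i) := hr.1.1 _ (by simp)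
  have h3 : t = affS → 3 ≤ n := by
    rintro rfl
    have h1 := hi.1
    have h2 := hi.2
    simp only [succ, pred, true_and] at hne
    split_ifs at hne <;> omega
  refine ⟨?_, h3⟩
  by_cases h0 : 1 ≤ i
  · refine not_reducedWordsAvoidTriples hr h0 ?_ (Or.inl rfl)
    cases t <;> simp only [IsLetter, IsSymm, true_implies] at * <;> omega
  · have h0' : i = 0 := by omega
    cases t
    · exact (h0 hi.1).elim
    · exact (hne' (by simp [pred, h0'])).elim
    · have hn := h3 rfl
      have hr' : affS.IsReducedWord n w
          (P ++ affS.pred n i :: i :: affS.pred n i :: Q) := by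
        refine (hr.congr (fun j hj => hr.1.1 j ?_) ?_).2 (by simp)
        · simp only [List.mem_append, List.mem_cons] at hj ⊢
          tauto
        · have := affS_braid (i := affS.pred n i) hn
          rw [affS_succ_pred hi.2] at this
          have h := congrArg (· * affS.wordProd n Q) this
          simp only [mul_assoc] at h
          simp only [wordProd_append, wordProd_cons, h]
      have h1 : affS.pred n i = n - 1 := by simp [pred, h0']
      exact not_reducedWordsAvoidTriples hr' (by omega) (by omega)
        (Or.inr (affS_succ_pred hi.2).symm)
    · exact (hne' (by simp [pred, h0'])).elim

theorem commute_wordProd (hn : 1 ≤ n) (hi : t.IsLetter n i) {M : List ℕ}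
    (hM : ∀ k ∈ M, t.IsLetter n k) (h1 : i ∉ M) (h2 : t.pred n i ∉ M) (h3 : t.succ n i ∉ M) :
    t.simple n i * t.wordProd n M = t.wordProd n M * t.simple n i := by
  refine (Commute.list_prod_right _ _ fun s hs => ?_ : Commute (t.simple n i) (t.wordProd n M)).eq
  obtain ⟨k, hk, rfl⟩ := List.mem_map.1 hs
  exact commute_simple hn hi (hM k hk) (ne_of_mem_of_not_mem hk h1)
    (ne_of_mem_of_not_mem hk h2) (ne_of_mem_of_not_mem hk h3)

/-- Two copies of a letter `i` in a reduced word, not separated by the neighbour `g i`, produce a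
triple `j (f j) j` in a reduced word. Here `f` and `g` are `succ` and `pred`, or conversely. -/
theorem exists_triple (hn : 1 ≤ n) {f g : ℕ → ℕ} {Ok : ℕ → Prop} {Bad : Prop}
    (hfg : ∀ (i : ℕ) (M : List ℕ), i ∉ M → f i ∉ M → g i ∉ M → t.pred n i ∉ M ∧ t.succ n i ∉ M)
    (hOk : ∀ i, Ok i → t.IsLetter n i → t.IsLetter n (f i) → f i ≠ i → Ok (f i) ∧ g (f i) = i)
    (hBad : ∀ (i : ℕ) (P Q : List ℕ), Ok i → f i ≠ g i → f i ≠ i →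
      t.IsReducedWord n w (P ++ i :: f i :: i :: Q) → Bad)
    (A M B : List ℕ) (hi : Ok i) (hM : g i ∉ M)
    (hr : t.IsReducedWord n w (A ++ i :: (M ++ i :: B))) : Bad := by
  induction hm : M.length using Nat.strong_induction_on generalizing i A M B with
  | _ m ih =>
    subst hm
    have hL := hr.1.1
    have hiL : t.IsLetter n i := hL i (by simp)
    -- Shrink the gap $M$. A further $i$ in $M$ gives a closer pair. With no `f i` in $M$, the two
    -- $s_i$ commute together and cancel, contradicting reducedness. Two copies of `f i` form a
    -- closer pair with no `g (f i) = i` between them. A single copy of `f i` becomes a triple once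
    -- both $s_i$ are moved next to it.
    by_cases hiM : i ∈ M
    · obtain ⟨M1, M2, rfl⟩ := List.append_of_mem hiM
      simp only [List.mem_append, List.mem_cons, not_or] at hM
      exact ih M2.length (by simp; omega) (A ++ i :: M1) M2 B hi hM.2.2 (by simpa using hr) rfl
    by_cases hf : f i ∈ M
    swap
    · have hML : ∀ k ∈ M, t.IsLetter n k := fun k hk => hL k (by simp [hk])
      obtain ⟨hp, hs⟩ := hfg i M hiM hf hM
      have hc := commute_wordProd hn hiL hML hiM hp hs
      have := (hr.congr (l' := A ++ (M ++ B)) (fun j hj => hL j (by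
          simp only [List.mem_append, List.mem_cons] at hj ⊢; tauto)) (by
        simp only [wordProd_append, wordProd_cons]
        rw [← mul_assoc (t.simple n i), hc, mul_assoc (t.wordProd n M),
          ← mul_assoc (t.simple n i), simple_mul_simple hn hiL, one_mul])).1
      simp at this
    obtain ⟨M1, M2, rfl, hf1⟩ := List.eq_append_cons_of_mem hf
    simp only [List.mem_append, List.mem_cons, not_or] at hM hiM
    have hfi : f i ≠ i := Ne.symm hiM.2.1
    have hfL : t.IsLetter n (f i) := hL _ (by simp)
    by_cases hf2 : f i ∈ M2
    · obtain ⟨M3, M4, rfl⟩ := List.append_of_mem hf2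
      simp only [List.mem_append, List.mem_cons, not_or] at hM hiM
      obtain ⟨hOk', hg⟩ := hOk i hi hiL hfL hfi
      exact ih M3.length (by simp; omega) (A ++ i :: M1) M3 (M4 ++ i :: B) hOk'
        (by rw [hg]; exact hiM.2.2.1) (by simpa using hr) rfl
    · have h1L : ∀ k ∈ M1, t.IsLetter n k := fun k hk => hL k (by simp [hk])
      have h2L : ∀ k ∈ M2, t.IsLetter n k := fun k hk => hL k (by simp [hk])
      obtain ⟨hp1, hs1⟩ := hfg i M1 hiM.1 hf1 hM.1
      obtain ⟨hp2, hs2⟩ := hfg i M2 hiM.2.2 hf2 hM.2.2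
      have hc1 := commute_wordProd hn hiL h1L hiM.1 hp1 hs1
      have hc2 := commute_wordProd hn hiL h2L hiM.2.2 hp2 hs2
      refine hBad i (A ++ M1) (M2 ++ B) hi (Ne.symm hM.2.1) hfi
        ((hr.congr (fun j hj => hL j ?_) ?_).2 ?_)
      · simp only [List.mem_append, List.mem_cons] at hj ⊢; tauto
      · simp only [wordProd_append, wordProd_cons, mul_assoc]
        rw [← mul_assoc (t.simple n i) (t.wordProd n M1), hc1,
          ← mul_assoc (t.simple n i) (t.wordProd n M2), hc2]
        simp only [mul_assoc]
      · simp; omega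

/-- The letter only increases during the search, so in a symmetric group it never reaches $0$, where
triples are allowed. -/
theorem not_avoid_of_not_pred_mem (hn : 1 ≤ n) {A M B : List ℕ} (hin : t.IsSymm → 1 ≤ i)
    (hM : t.pred n i ∉ M) (hr : t.IsReducedWord n w (A ++ i :: (M ++ i :: B))) :
    ¬ t.ReducedWordsAvoidTriples n w ∧ (t = affS → 3 ≤ n) := by
  refine exists_triple (f := t.succ n) (g := t.pred n) (Ok := fun i => t.IsSymm → 1 ≤ i) hn
    (fun i M _ h h' => ⟨h', h⟩) ?_ ?_ A M B hin hM hr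
  · intro i hi hiL hfL hne
    cases t
    · simp [succ, pred]
    · simp [succ, pred]
    · exact ⟨fun h => h.elim, affS_pred_succ⟩
    · simp [succ, pred]
  · intro i P Q hi hne _ hr
    exact not_reducedWordsAvoidTriples_of_succ hr hi hne

theorem not_avoid_of_not_succ_mem (hn : 1 ≤ n) {A M B : List ℕ} (hin : t.IsSymm → i < n)
    (hM : t.succ n i ∉ M) (hr : t.IsReducedWord n w (A ++ i :: (M ++ i :: B))) :
    ¬ t.ReducedWordsAvoidTriples n w ∧ (t = affS → 3 ≤ n) := by
  refine exists_triple (f := t.pred n) (g := t.succ n) (Ok := fun i => t.IsSymm → i < n) hn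
    (fun i M _ h h' => ⟨h, h'⟩) ?_ ?_ A M B hin hM hr
  · intro i hi hiL hfL hne
    cases t
    · simp only [succ, pred, IsSymm, reduceCtorEq, false_and, if_false] at *
      exact ⟨fun h => h.elim, by omega⟩
    · simp only [succ, pred, IsSymm, reduceCtorEq, false_and, if_false] at *
      exact ⟨fun _ => by have := hi trivial; omega, by omega⟩
    · exact ⟨fun h => h.elim, affS_succ_pred hiL.2⟩
    · simp only [succ, pred, IsSymm, reduceCtorEq, false_and, if_false] at *
      exact ⟨fun _ => by have := hi trivial; omega, by omega⟩
  · intro i P Q hi hne hne' hr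
    exact not_reducedWordsAvoidTriples_of_pred hr hi hne hne'

/-- The core of (B$'$) implies (A), applied to the first letter that fails to be a gain. The second
alternative covers the affine groups of window size below $3$, where no triple condition is needed.
-/
theorem IsReducedWord.allGain (hr : t.IsReducedWord n w l) (hn : 1 ≤ n)
    (h : t.ReducedWordsAvoidTriples n w ∨ (t = affS ∧ n < 3)) : t.AllGain n 1 l := by
  have hbad : ¬ (¬ t.ReducedWordsAvoidTriples n w ∧ (t = affS → 3 ≤ n)) := by
    rintro ⟨h1, h2⟩
    rcases h with h | ⟨h3, h4⟩
    · exact h1 h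
    · exact absurd (h2 h3) (by omega)
  by_contra hng
  obtain ⟨A, i, B, rfl, hA, hg⟩ := exists_not_gain_of_not_allGain hng
  rw [one_mul] at hg
  have hi : t.IsLetter n i := hr.1.1 i (by simp)
  have hAL : ∀ k ∈ A, t.IsLetter n k := fun k hk => hr.1.1 k (by simp [hk])
  have hv := wordProd_mem_group hn hAL
  have h321 := hA.not_has321 hn hAL (one_mem _) not_has321_one
  rw [one_mul] at h321
  set v := t.wordProd n A
  have hab := left_lt_right hn hi
  -- Were $i$ a descent of the $321$-avoiding $v$, then $vs_i$ would have a word one letter shorter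
  -- than $A$, and using it in place of $A$ followed by $i$ would shorten a reduced word.
  have hlt : v (t.left n i) < v (t.right n i) := by
    by_contra hle
    have hlt : v (t.right n i) < v (t.left n i) :=
      lt_of_le_of_ne (not_lt.1 hle) fun e => hab.ne' (v.injective e)
    have hs := simple_mem_group hn hi
    have hss : v * t.simple n i * t.simple n i = v := by
      rw [mul_assoc, simple_mul_simple hn hi, mul_one]
    have hgain := gain_mul_simple_of_descent hn hi hv h321 hlt
    have hlt' : (v * t.simple n i) (t.left n i) < (v * t.simple n i) (t.right n i) := by
      simpa [Equiv.Perm.mul_apply, simple_left hn hi, simple_right hn hi]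
    have h321' : ¬ t.Has321 n (v * t.simple n i) := fun h => h321 (by
      have := h.mul_simple hn hi (mul_mem hv hs) hlt'
      rwa [hss] at this)
    have hd := (disarray_mul_simple hn hi (mul_mem hv hs)).2.2 hgain
    rw [hss, (disarray_wordProd_eq_iff hn hAL).2 hA] at hd
    obtain ⟨l', hl', hlen⟩ := exists_word hn (mul_mem hv hs)
    have hlen' := hlen h321'
    have := (hr.congr (l' := l' ++ B) (fun j hj => by
      rcases List.mem_append.1 hj with hj | hj
      · exact hl'.1 j hj
      · exact hr.1.1 j (by simp [hj])) (by
      rw [wordProd_append, show t.wordProd n l' = _ from hl'.2, wordProd_append, wordProd_cons,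
        mul_assoc])).1
    simp only [List.length_append, List.length_cons] at this
    omega
  -- At a reflection $v(a)+v(b)=a+b$, so together with $v(a)<v(b)$ the letter would be a gain after
  -- all.
  have hin : t.IsInner n i := by
    by_contra hin
    rcases right_eq_left_add hn hi with hb | ⟨ht, hb, -, hN⟩
    · apply hin
      intro ht
      rcases letter_cases hn hi with h | h | h | h
      · exact (h.1 ht).elim
      all_goals omega
    · have hsum := apply_left_add_apply_right hv ht hN
      have ha := le_left_or_right_le hn hi (apply_unfrozen hv (left_mem_unfrozen hn hi))
      exact hg ⟨by omega, by omega⟩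
  have ha := le_left_or_right_le hn hi (apply_unfrozen hv (left_mem_unfrozen hn hi))
  have hb := le_left_or_right_le hn hi (apply_unfrozen hv (right_mem_unfrozen hn hi))
  by_cases h1 : v (t.left n i) ≤ t.left n i
  · have h2 : v (t.right n i) < t.right n i := not_le.1 fun h2 => hg ⟨h1, h2⟩
    obtain ⟨A', M, rfl, hM⟩ := hA.exists_last_of_gt hn hi hin hAL h2
    refine hbad (not_avoid_of_not_succ_mem (i := i) (A := A') (M := M) (B := B) hn ?_ hM
      (by simpa using hr))
    intro ht
    have := (hin ht).2
    rcases letter_cases hn hi with h | h | h | h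
    · exact (h.1 ht).elim
    all_goals omega
  · obtain ⟨A', M, rfl, hM⟩ := hA.exists_last_of_lt hn hi hin hAL (not_le.1 h1)
    refine hbad (not_avoid_of_not_pred_mem (i := i) (A := A') (M := M) (B := B) hn ?_ hM
      (by simpa using hr))
    intro ht
    have := (hin ht).1
    omega

/-! ### Separation in reduced words, and the remaining implications -/

theorem separated_of_forall {i j : ℕ}
    (h : ∀ A M B, l = A ++ i :: (M ++ i :: B) → j ∈ M) : Separated l i j := by
  intro p q hpq hp hq
  obtain ⟨hp', hpi⟩ := List.getElem?_eq_some_iff.1 hp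
  obtain ⟨hq', hqi⟩ := List.getElem?_eq_some_iff.1 hq
  have e1 : l = l.take p ++ i :: l.drop (p + 1) := by
    rw [← hpi, List.getElem_cons_drop, List.take_append_drop]
  have hd : q - (p + 1) < (l.drop (p + 1)).length := by rw [List.length_drop]; omega
  have hdi : (l.drop (p + 1))[q - (p + 1)] = i := by
    rw [List.getElem_drop, ← hqi]
    congr 1; omega
  have e2 : l.drop (p + 1) = (l.drop (p + 1)).take (q - (p + 1)) ++
      i :: (l.drop (p + 1)).drop (q - (p + 1) + 1) := by
    conv_lhs => rw [← List.take_append_drop (q - (p + 1)) (l.drop (p + 1))]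
    rw [← hdi, List.getElem_cons_drop]
  have hj := h _ _ _ (e1.trans (by rw [← e2]))
  obtain ⟨r, hr, hrj⟩ := List.mem_iff_getElem.1 hj
  rw [List.length_take, List.length_drop] at hr
  refine ⟨p + 1 + r, by omega, by omega, ?_⟩
  rw [List.getElem_take, List.getElem_drop] at hrj
  exact List.getElem?_eq_some_iff.2 ⟨_, hrj⟩

theorem reducedWordsSeparated_of_disarray (hn : 1 ≤ n)
    (h : disarray n w = 2 * t.coxeterLength n w) : t.ReducedWordsSeparated n w := by
  intro l hr i h1 h2
  have hi : t.IsLetter n i := isLetter_of_mem_window h1 h2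
  have hin : t.IsInner n i := isInner_of_mem_window h1 h2
  have hg := (hr.disarray_eq_iff hn).1 h
  have key : ∀ A M B, l = A ++ i :: (M ++ i :: B) → t.pred n i ∈ M ∧ t.succ n i ∈ M := by
    rintro A M B rfl
    have hAL : ∀ k ∈ A, t.IsLetter n k := fun k hk => hr.1.1 k (by simp [hk])
    have hML : ∀ k ∈ M, t.IsLetter n k := fun k hk => hr.1.1 k (by simp [hk])
    have hv := wordProd_mem_group hn hAL
    rw [allGain_append, one_mul] at hg
    obtain ⟨-, hgi, hgM⟩ := hg
    exact ⟨hgM.pred_mem hn hi hin hML (hgi.lt_apply_of_up hn hi hv up_left),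
      hgM.succ_mem hn hi hin hML (hgi.apply_lt_of_down hn hi hv down_right)⟩
  rw [letter_sub_one hi h1, letter_add_one hi]
  exact ⟨separated_of_forall fun A M B e => (key A M B e).1,
    separated_of_forall fun A M B e => (key A M B e).2⟩

theorem Separated.mem_of_triple {P Q : List ℕ} {j : ℕ}
    (h : Separated (P ++ i :: k :: i :: Q) i j) : k = j := by
  obtain ⟨r, h1, h2, h3⟩ := h P.length (P.length + 2) (by omega) (by simp)
    (by rw [List.getElem?_append_right (by omega)]; simp)
  obtain rfl : r = P.length + 1 := by omega
  rw [List.getElem?_append_right (by omega)] at h3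
  simpa using h3

/-- In a triple, the single middle letter would have to be both neighbours of $i$; nondegeneracy
makes them distinct. -/
theorem ReducedWordsSeparated.avoidTriples (h : t.ReducedWordsSeparated n w)
    (ht : t.Nondegenerate n) : t.ReducedWordsAvoidTriples n w := by
  intro l hr i h1 h2
  have hi : t.IsLetter n i := isLetter_of_mem_window h1 h2
  have hne := pred_ne_succ ht h1
  have hs := h l hr i h1 h2
  rw [letter_sub_one hi h1, letter_add_one hi] at *
  constructor
  · rintro ⟨P, Q, rfl⟩
    rw [List.append_assoc] at hs
    exact hne hs.2.mem_of_triple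
  · rintro ⟨P, Q, rfl⟩
    rw [List.append_assoc] at hs
    exact hne.symm hs.1.mem_of_triple

theorem disarray_eq_of_avoidTriples (hn : 1 ≤ n) (hw : w ∈ t.group n)
    (h : t.ReducedWordsAvoidTriples n w ∨ (t = affS ∧ n < 3)) :
    disarray n w = 2 * t.coxeterLength n w := by
  obtain ⟨l, hl⟩ := exists_reducedWord hn hw
  exact (hl.disarray_eq_iff hn).2 (hl.allGain hn h)

theorem disarray_eq_of_separated (hn : 1 ≤ n) (hw : w ∈ t.group n)
    (h : t.ReducedWordsSeparated n w) : disarray n w = 2 * t.coxeterLength n w := by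
  by_cases ht : t.Nondegenerate n
  · exact disarray_eq_of_avoidTriples hn hw (Or.inl (h.avoidTriples ht))
  -- Two degenerate cases remain: affine $S_n$ with $n\le2$, treated by the separate alternative,
  -- and affine $S^C_1$, where the index range $[n-1]$ is empty and avoidance is vacuous.
  · apply disarray_eq_of_avoidTriples hn hw
    cases t
    · exact (ht hn).elim
    · exact (ht hn).elim
    · exact Or.inr ⟨rfl, not_le.1 ht⟩
    · have : n < 2 := not_le.1 ht
      exact Or.inl fun l _ i h1 h2 => by omega

end GeorgeType

theorem mainTheorem1 (t : GeorgeType) (n : ℕ) (hn : 1 ≤ n) (w : Equiv.Perm ℤ)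
    (hw : w ∈ t.group n) :
    List.TFAE [(disarray n w : ℚ) / 2 = t.coxeterLength n w,
      t.ReducedWordsSeparated n w,
      ¬ t.GloballyContains n w pattern321] ∧
    (t.Nondegenerate n →
      List.TFAE [(disarray n w : ℚ) / 2 = t.coxeterLength n w,
        t.ReducedWordsSeparated n w,
        ¬ t.GloballyContains n w pattern321,
        t.ReducedWordsAvoidTriples n w]) := by
  have hA : (disarray n w : ℚ) / 2 = t.coxeterLength n w ↔
      disarray n w = 2 * t.coxeterLength n w := by
    rw [div_eq_iff two_ne_zero, mul_comm]
    exact_mod_cast Iff.rfl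
  have hB : disarray n w = 2 * t.coxeterLength n w ↔ t.ReducedWordsSeparated n w :=
    ⟨GeorgeType.reducedWordsSeparated_of_disarray hn, GeorgeType.disarray_eq_of_separated hn hw⟩
  have hC := GeorgeType.disarray_eq_iff_not_has321 hn hw
  rw [hA, GeorgeType.globallyContains_pattern321, ← hC, ← hB]
  refine ⟨by tfae_finish, fun ht => ?_⟩
  have hB' : disarray n w = 2 * t.coxeterLength n w ↔ t.ReducedWordsAvoidTriples n w :=
    ⟨fun h => (hB.1 h).avoidTriples ht,
      fun h => GeorgeType.disarray_eq_of_avoidTriples hn hw (Or.inl h)⟩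
  rw [← hB']
  tfae_finish
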